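/- Let $q_1,q_2$ be integers with $1\le q_1\le q_2$, let $A=\begin{pmatrix}3q_1&0\\0&3q_2\end{pmatrix}$ and $\mathcal D=\left\{\binom00,\binom10,\binom01\right\}$, and let $\mu_{A,\mathcal D}$ be the unique Borel probability measure on $\mathbb R^2$ with $\mu_{A,\mathcal D}(E)=\frac13\sum_{d\in\mathcal D}\mu_{A,\mathcal D}(AE-d)$ for all Borel sets $E\subseteq\mathbb R^2$. For $\lambda\in\mathbb R^2$ put $e_\lambda(x)=e^{-2\pi i\langle\lambda,x\rangle}$. A set $\Lambda\subseteq\mathbb R^2$ is an orthogonal set of $\mu_{A,\mathcal D}$ if $e_\lambda$ and $e_{\lambda'}$ are orthogonal in $L^2(\mu_{A,\mathcal D})$ for all distinct $\lambda,\lambda'\in\Lambda$, and a spectrum of $\mu_{A,\mathcal D}$ if it is countable and $\{e_\lambda:\lambda\in\Lambda\}$ is an orthonormal basis of $L^2(\mu_{A,\mathcal D})$. For $r>0$ let $D_r^+(\Lambda)=\limsup_{h\to\infty}\sup_{x\in\mathbb R^2}\frac{\#(\Lambda\cap B(x,h))}{h^r}$, where $B(x,h)$ is the open Euclidean ball, and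 let $\dim_{Be}(\Lambda)=\inf\{r>0:D_r^+(\Lambda)=0\}$ be the upper Beurling dimension of $\Lambda$ (with $\inf\emptyset=\infty$). Then every orthogonal set $\Lambda$ of $\mu_{A,\mathcal D}$ satisfies $\dim_{Be}(\Lambda)\le\frac{\log 3}{\log(3q_2)}$. Moreover, if $\Lambda$ is a spectrum of $\mu_{A,\mathcal D}$ and there is an integer $p\ge1$ with $\sup_{\lambda\in\Lambda}\inf_{\gamma\in\Lambda}\|A^{-p}\lambda-\gamma\|<\infty$, then $\dim_{Be}(\Lambda)=\frac{\log 3}{\log(3q_2)}$. -/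

import Mathlib

open MeasureTheory Filter Topology
open scoped ENNReal NNReal InnerProductSpace

namespace Sierpinski

/-- The Euclidean plane. -/
abbrev Plane : Type := EuclideanSpace ℝ (Fin 2)

/-! ### Beurling dimension -/

/-- The upper `r`-Beurling density
`limsup_{h → ∞} sup_x #(Λ ∩ B(x, h)) / h ^ r`, with values in `[0, ∞]`. -/
noncomputable def upperBeurlingDensity (r : ℝ) (Λ : Set Plane) : ℝ≥0∞ :=
  limsup (fun h : ℝ =>
    ⨆ x : Plane, ((Λ ∩ Metric.ball x h).encard : ℝ≥0∞) / ENNReal.ofReal (h ^ r)) atTop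

/-- The upper Beurling dimension `inf {r > 0 : D_r^+(Λ) = 0}`, with values in `[0, ∞]`
(it is `∞` if there is no such `r`). -/
noncomputable def beurlingDim (Λ : Set Plane) : ℝ≥0∞ :=
  ⨅ (r : ℝ) (_ : 0 < r) (_ : upperBeurlingDensity r Λ = 0), ENNReal.ofReal r

/-! ### Orthogonal sets and spectra of a measure -/

/-- The exponential function `x ↦ e ^ (-2 π i ⟨l, x⟩)`. -/
noncomputable def expFun (l x : Plane) : ℂ :=
  Complex.exp (-2 * Real.pi * Complex.I * ((⟪l, x⟫_ℝ : ℝ) : ℂ))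

theorem norm_expFun (l x : Plane) : ‖expFun l x‖ = 1 := by
  have : (-2 * Real.pi * Complex.I * ((⟪l, x⟫_ℝ : ℝ) : ℂ))
      = ((-2 * Real.pi * ⟪l, x⟫_ℝ : ℝ) : ℂ) * Complex.I := by
    push_cast; ring
  rw [expFun, this, Complex.norm_exp_ofReal_mul_I]

theorem memLp_expFun (μ : Measure Plane) [IsFiniteMeasure μ] (l : Plane) :
    MemLp (expFun l) 2 μ := by
  refine MemLp.of_bound (C := 1) ?_ (ae_of_all _ fun x => (norm_expFun l x).le)
  have : Continuous (expFun l) := by unfold expFun; fun_prop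
  exact this.aestronglyMeasurable

/-- The exponential function `x ↦ e ^ (-2 π i ⟨l, x⟩)` as an element of `L²(μ)`. -/
noncomputable def expLp (μ : Measure Plane) [IsFiniteMeasure μ] (l : Plane) : Lp ℂ 2 μ :=
  (memLp_expFun μ l).toLp (expFun l)

/-- `Λ` is an orthogonal set of `μ`: the exponentials with frequencies in `Λ` are pairwise
orthogonal in `L²(μ)`. -/
def IsOrthogonalSet (μ : Measure Plane) [IsFiniteMeasure μ] (Λ : Set Plane) : Prop :=
  Λ.Pairwise fun l l' => ⟪expLp μ l, expLp μ l'⟫_ℂ = 0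

/-- `Λ` is a spectrum of `μ`: it is countable and the exponentials with frequencies in `Λ` form
an orthonormal basis of `L²(μ)`. -/
def IsSpectrum (μ : Measure Plane) [IsFiniteMeasure μ] (Λ : Set Plane) : Prop :=
  Λ.Countable ∧ Orthonormal ℂ (fun l : Λ => expLp μ l) ∧
    (Submodule.span ℂ (Set.range fun l : Λ => expLp μ l)).topologicalClosure = ⊤

/-! ### The Sierpiński-type measure -/

/-- The matrix `A = diag(3 q₁, 3 q₂)`. -/
noncomputable def matA (q₁ q₂ : ℤ) : Matrix (Fin 2) (Fin 2) ℝ :=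
  Matrix.diagonal ![3 * (q₁ : ℝ), 3 * (q₂ : ℝ)]

/-- The digits `(0,0)`, `(1,0)`, `(0,1)`. -/
noncomputable def digit : Fin 3 → Plane := ![!₂[0, 0], !₂[1, 0], !₂[0, 1]]

/-- The uniform probability measure on the three digit labels. -/
noncomputable def unif : Measure (Fin 3) := (PMF.uniformOfFintype (Fin 3)).toMeasure

instance : IsProbabilityMeasure unif := by unfold unif; infer_instance

/-- The random series `∑_{j ≥ 1} A^{-j} d_j` as a function of the digit sequence. -/
noncomputable def series (q₁ q₂ : ℤ) (ω : ℕ → Fin 3) : Plane :=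
  ∑' j : ℕ, Matrix.toEuclideanLin ((matA q₁ q₂)⁻¹ ^ (j + 1)) (digit (ω j))

/-- The Sierpiński-type measure `μ_{A,𝒟}`: the law of `∑_{j ≥ 1} A^{-j} d_j` with independent
digits `d_j` uniformly distributed in `{(0,0), (1,0), (0,1)}`. By `sierpinskiMeasure_apply` and
`eq_sierpinskiMeasure` below it is the unique Borel probability measure with
`μ(E) = (1/3) ∑_d μ(A E - d)` for all Borel sets `E`. -/
noncomputable def sierpinskiMeasure (q₁ q₂ : ℤ) : Measure Plane :=
  (Measure.infinitePi fun _ : ℕ => unif).map (series q₁ q₂)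

instance (q₁ q₂ : ℤ) : IsFiniteMeasure (sierpinskiMeasure q₁ q₂) := by
  unfold sierpinskiMeasure; infer_instance

/-! ### The invariance equation characterizes the measure -/

theorem matA_inv {q₁ q₂ : ℤ} (h₁ : 1 ≤ q₁) (h₂ : 1 ≤ q₂) :
    (matA q₁ q₂)⁻¹ = Matrix.diagonal ![(3 * (q₁ : ℝ))⁻¹, (3 * (q₂ : ℝ))⁻¹] := by
  have h1 : (q₁ : ℝ) ≠ 0 := by exact_mod_cast (by omega : q₁ ≠ 0)
  have h2 : (q₂ : ℝ) ≠ 0 := by exact_mod_cast (by omega : q₂ ≠ 0)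
  apply Matrix.inv_eq_left_inv
  rw [matA, Matrix.diagonal_mul_diagonal, ← Matrix.diagonal_one]
  congr 1
  funext i
  fin_cases i <;> simp <;> field_simp

theorem norm_inv_le {q₁ q₂ : ℤ} (h₁ : 1 ≤ q₁) (h₂ : 1 ≤ q₂) (x : Plane) :
    ‖Matrix.toEuclideanLin (matA q₁ q₂)⁻¹ x‖ ≤ 1 / 3 * ‖x‖ := by
  have h1 : (1 : ℝ) ≤ q₁ := by exact_mod_cast h₁
  have h2 : (1 : ℝ) ≤ q₂ := by exact_mod_cast h₂
  have key : ∀ {q : ℝ} (t : ℝ), 1 ≤ q → ((3 * q)⁻¹ * t) ^ 2 ≤ (1 / 3) ^ 2 * t ^ 2 := by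
    intro q t hq
    rw [mul_pow]
    have : (3 * q)⁻¹ ≤ 1 / 3 := by
      rw [one_div]; exact inv_anti₀ (by norm_num) (by linarith)
    have h0 : 0 ≤ (3 * q)⁻¹ := by positivity
    gcongr
  rw [matA_inv h₁ h₂, EuclideanSpace.norm_eq, EuclideanSpace.norm_eq,
    ← Real.sqrt_sq (show (0 : ℝ) ≤ 1 / 3 by norm_num), ← Real.sqrt_mul (by positivity)]
  apply Real.sqrt_le_sqrt
  simp only [Fin.sum_univ_two, Real.norm_eq_abs, sq_abs, Matrix.toLpLin_apply,
    Matrix.mulVec_diagonal]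
  have := key (x 0) h1
  have := key (x 1) h2
  simp at *
  linarith

theorem norm_inv_pow_le {q₁ q₂ : ℤ} (h₁ : 1 ≤ q₁) (h₂ : 1 ≤ q₂) (j : ℕ) (x : Plane) :
    ‖Matrix.toEuclideanLin ((matA q₁ q₂)⁻¹ ^ j) x‖ ≤ (1 / 3) ^ j * ‖x‖ := by
  induction j generalizing x with
  | zero => simp
  | succ k ih =>
    have : Matrix.toEuclideanLin ((matA q₁ q₂)⁻¹ ^ (k + 1)) x =
        Matrix.toEuclideanLin ((matA q₁ q₂)⁻¹ ^ k)
          (Matrix.toEuclideanLin (matA q₁ q₂)⁻¹ x) := by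
      simp [Matrix.toLpLin_apply, pow_succ]
    rw [this]
    calc _ ≤ (1 / 3) ^ k * ‖Matrix.toEuclideanLin (matA q₁ q₂)⁻¹ x‖ := ih _
      _ ≤ (1 / 3) ^ k * (1 / 3 * ‖x‖) := by gcongr; exact norm_inv_le h₁ h₂ x
      _ = _ := by ring

theorem norm_digit_le (i : Fin 3) : ‖digit i‖ ≤ 1 := by
  fin_cases i <;> simp [digit, EuclideanSpace.norm_eq]

theorem norm_term_le {q₁ q₂ : ℤ} (h₁ : 1 ≤ q₁) (h₂ : 1 ≤ q₂) (j : ℕ) (i : Fin 3) :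
    ‖Matrix.toEuclideanLin ((matA q₁ q₂)⁻¹ ^ (j + 1)) (digit i)‖ ≤ (1 / 3) ^ (j + 1) :=
  (norm_inv_pow_le h₁ h₂ _ _).trans
    (mul_le_of_le_one_right (by positivity) (norm_digit_le i))

theorem summable_geom : Summable fun j : ℕ => ((1 : ℝ) / 3) ^ (j + 1) :=
  (summable_nat_add_iff 1).2 (summable_geometric_of_lt_one (by norm_num) (by norm_num))

theorem summable_series {q₁ q₂ : ℤ} (h₁ : 1 ≤ q₁) (h₂ : 1 ≤ q₂) (ω : ℕ → Fin 3) :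
    Summable fun j : ℕ => Matrix.toEuclideanLin ((matA q₁ q₂)⁻¹ ^ (j + 1)) (digit (ω j)) :=
  Summable.of_norm_bounded summable_geom fun j => norm_term_le h₁ h₂ j (ω j)

theorem continuous_series {q₁ q₂ : ℤ} (h₁ : 1 ≤ q₁) (h₂ : 1 ≤ q₂) :
    Continuous (series q₁ q₂) := by
  refine continuous_tsum (fun j => ?_) summable_geom fun j ω => norm_term_le h₁ h₂ j (ω j)
  exact (continuous_of_discreteTopology
    (f := fun i : Fin 3 => Matrix.toEuclideanLin ((matA q₁ q₂)⁻¹ ^ (j + 1)) (digit i))).comp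
    (continuous_apply j)

theorem isProbabilityMeasure_sierpinskiMeasure {q₁ q₂ : ℤ} (h₁ : 1 ≤ q₁) (h₂ : 1 ≤ q₂) :
    IsProbabilityMeasure (sierpinskiMeasure q₁ q₂) :=
  Measure.isProbabilityMeasure_map (continuous_series h₁ h₂).measurable.aemeasurable

/-- Prepend a digit to a digit sequence. -/
def consSeq (p : Fin 3 × (ℕ → Fin 3)) : ℕ → Fin 3 := fun n => Nat.casesOn n p.1 p.2

theorem measurable_consSeq : Measurable consSeq := by
  refine measurable_pi_lambda _ fun n => ?_
  cases n with
  | zero => exact measurable_fst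
  | succ n => exact (measurable_pi_apply n).comp measurable_snd

theorem series_consSeq {q₁ q₂ : ℤ} (h₁ : 1 ≤ q₁) (h₂ : 1 ≤ q₂) (p : Fin 3 × (ℕ → Fin 3)) :
    series q₁ q₂ (consSeq p) =
      Matrix.toEuclideanLin (matA q₁ q₂)⁻¹ (series q₁ q₂ p.2 + digit p.1) := by
  have hs := summable_series h₁ h₂ (consSeq p)
  rw [series, hs.tsum_eq_zero_add, map_add, add_comm]
  congr 1
  · have hc := (LinearMap.toContinuousLinearMap
      (Matrix.toEuclideanLin (matA q₁ q₂)⁻¹)).map_tsum (summable_series h₁ h₂ p.2)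
    rw [LinearMap.coe_toContinuousLinearMap'] at hc
    rw [series, hc]
    refine tsum_congr fun j => ?_
    simp [consSeq, Matrix.toLpLin_apply, pow_succ']
  · simp [consSeq]

theorem map_consSeq :
    (unif.prod (Measure.infinitePi fun _ : ℕ => unif)).map consSeq =
      Measure.infinitePi fun _ : ℕ => unif := by
  classical
  refine Measure.eq_infinitePi _ fun s t _ => ?_
  obtain ⟨N, hN⟩ : ∃ N, s ⊆ Finset.range (N + 1) :=
    ⟨s.sup id, fun i hi => Finset.mem_range.2 (Nat.lt_succ_of_le (Finset.le_sup (f := id) hi))⟩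
  set t' : ℕ → Set (Fin 3) := fun i => if i ∈ s then t i else Set.univ with ht'
  have hpi : (s : Set ℕ).pi t = (Finset.range (N + 1) : Set ℕ).pi t' := by
    ext ω
    simp only [Set.mem_pi, Finset.mem_coe, ht']
    constructor
    · intro h i _
      split_ifs with his
      · exact h i his
      · trivial
    · intro h i hi
      simpa [hi] using h i (hN hi)
  have hprod : ∏ i ∈ s, unif (t i) = ∏ i ∈ Finset.range (N + 1), unif (t' i) := by
    rw [← Finset.prod_subset hN (f := fun i => unif (t' i))]
    · exact Finset.prod_congr rfl fun i hi => by simp [ht', hi]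
    · intro i _ hi
      simp [ht', hi]
  have hpre : consSeq ⁻¹' ((Finset.range (N + 1) : Set ℕ).pi t') =
      t' 0 ×ˢ ((Finset.range N : Set ℕ).pi fun n => t' (n + 1)) := by
    ext p
    simp only [Set.mem_preimage, Set.mem_pi, Finset.mem_coe, Finset.mem_range, Set.mem_prod]
    constructor
    · intro h
      exact ⟨h 0 (by omega), fun n hn => h (n + 1) (by omega)⟩
    · rintro ⟨h0, h⟩ n hn
      cases n with
      | zero => exact h0
      | succ n => exact h n (by omega)
  have hms : MeasurableSet ((Finset.range (N + 1) : Set ℕ).pi t') :=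
    MeasurableSet.pi (Finset.countable_toSet _) fun _ _ => MeasurableSet.of_discrete
  rw [hpi, hprod, Measure.map_apply measurable_consSeq hms, hpre, Measure.prod_prod,
    Measure.infinitePi_pi _ fun _ _ => MeasurableSet.of_discrete, Finset.prod_range_succ',
    mul_comm]

/-- The contraction `x ↦ A⁻¹ (x + d)`. -/
noncomputable def contr (q₁ q₂ : ℤ) (i : Fin 3) (x : Plane) : Plane :=
  Matrix.toEuclideanLin (matA q₁ q₂)⁻¹ (x + digit i)

theorem continuous_contr (q₁ q₂ : ℤ) (i : Fin 3) : Continuous (contr q₁ q₂ i) :=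
  (LinearMap.continuous_of_finiteDimensional _).comp (continuous_id.add continuous_const)

theorem image_eq_preimage {q₁ q₂ : ℤ} (h₁ : 1 ≤ q₁) (h₂ : 1 ≤ q₂) (i : Fin 3)
    (E : Set Plane) :
    (fun x => Matrix.toEuclideanLin (matA q₁ q₂) x - digit i) '' E = contr q₁ q₂ i ⁻¹' E := by
  have h1 : (q₁ : ℝ) ≠ 0 := by exact_mod_cast (by omega : q₁ ≠ 0)
  have h2 : (q₂ : ℝ) ≠ 0 := by exact_mod_cast (by omega : q₂ ≠ 0)
  have hdet : IsUnit (matA q₁ q₂).det := by simp [matA, h1, h2]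
  refine congrFun (Set.image_eq_preimage_of_inverse (fun x => ?_) fun x => ?_) E
  · simp only [contr, sub_add_cancel]
    rw [Matrix.toLpLin_apply, Matrix.toLpLin_apply, Matrix.mulVec_mulVec,
      Matrix.nonsing_inv_mul _ hdet, Matrix.one_mulVec]
  · simp only [contr]
    rw [Matrix.toLpLin_apply, Matrix.toLpLin_apply, Matrix.mulVec_mulVec,
      Matrix.mul_nonsing_inv _ hdet, Matrix.one_mulVec]
    exact add_sub_cancel_right x (digit i)

theorem unif_singleton (i : Fin 3) : unif {i} = 3⁻¹ := by
  simp [unif]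

/-- The invariance equation `μ(E) = (1/3) ∑_d μ(A E - d)`. -/
theorem sierpinskiMeasure_apply {q₁ q₂ : ℤ} (h₁ : 1 ≤ q₁) (h₂ : 1 ≤ q₂) {E : Set Plane}
    (hE : MeasurableSet E) :
    sierpinskiMeasure q₁ q₂ E =
      3⁻¹ * ∑ i, sierpinskiMeasure q₁ q₂
        ((fun x => Matrix.toEuclideanLin (matA q₁ q₂) x - digit i) '' E) := by
  have hX := (continuous_series h₁ h₂).measurable
  have hpre : MeasurableSet (consSeq ⁻¹' (series q₁ q₂ ⁻¹' E)) :=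
    measurable_consSeq (hX hE)
  simp only [image_eq_preimage h₁ h₂]
  conv_lhs => rw [sierpinskiMeasure, Measure.map_apply hX hE, ← map_consSeq,
    Measure.map_apply measurable_consSeq (hX hE), Measure.prod_apply hpre, lintegral_fintype]
  rw [Finset.mul_sum]
  refine Finset.sum_congr rfl fun i _ => ?_
  rw [unif_singleton, mul_comm, sierpinskiMeasure,
    Measure.map_apply hX ((continuous_contr q₁ q₂ i).measurable hE)]
  congr 2
  ext ω
  simp [series_consSeq h₁ h₂, contr]

/-- The Fourier transform equation implied by the invariance equation. -/
theorem charFun_eq_of_invariant {q₁ q₂ : ℤ} (h₁ : 1 ≤ q₁) (h₂ : 1 ≤ q₂) (ν : Measure Plane)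
    [IsProbabilityMeasure ν]
    (hν : ∀ E, MeasurableSet E → ν E =
      3⁻¹ * ∑ i, ν ((fun x => Matrix.toEuclideanLin (matA q₁ q₂) x - digit i) '' E))
    (t : Plane) :
    charFun ν t = (1 / 3 * ∑ i, Complex.exp
      (⟪Matrix.toEuclideanLin (matA q₁ q₂)⁻¹ (digit i), t⟫_ℝ * Complex.I)) *
        charFun ν (Matrix.toEuclideanLin (matA q₁ q₂)⁻¹ t) := by
  have hsum : ν = (3⁻¹ : ℝ≥0∞) • ∑ i, ν.map (contr q₁ q₂ i) := by
    ext E hE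
    rw [hν E hE]
    simp only [image_eq_preimage h₁ h₂, Measure.smul_apply, Measure.finsetSum_apply, smul_eq_mul]
    congr 1
    exact Finset.sum_congr rfl fun i _ =>
      (Measure.map_apply (continuous_contr q₁ q₂ i).measurable hE).symm
  have hint : ∀ (m : Measure Plane) [IsProbabilityMeasure m],
      Integrable (fun x : Plane => Complex.exp (⟪x, t⟫_ℝ * Complex.I)) m := by
    intro m _
    refine Integrable.of_bound (C := 1) (Continuous.aestronglyMeasurable (by fun_prop))
      (ae_of_all _ fun x => (Complex.norm_exp_ofReal_mul_I _).le)
  have hsymm : ∀ x, ⟪Matrix.toEuclideanLin (matA q₁ q₂)⁻¹ x, t⟫_ℝ =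
      ⟪x, Matrix.toEuclideanLin (matA q₁ q₂)⁻¹ t⟫_ℝ := by
    intro x
    rw [matA_inv h₁ h₂]
    simp [PiLp.inner_apply, Matrix.toLpLin_apply, Fin.sum_univ_two]
    ring
  have hprob : ∀ i, IsProbabilityMeasure (ν.map (contr q₁ q₂ i)) := fun i =>
    Measure.isProbabilityMeasure_map (continuous_contr q₁ q₂ i).measurable.aemeasurable
  have hi : ∀ i, ∫ x, Complex.exp (⟪x, t⟫_ℝ * Complex.I) ∂(ν.map (contr q₁ q₂ i)) =
      Complex.exp (⟪Matrix.toEuclideanLin (matA q₁ q₂)⁻¹ (digit i), t⟫_ℝ * Complex.I) *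
        charFun ν (Matrix.toEuclideanLin (matA q₁ q₂)⁻¹ t) := by
    intro i
    rw [integral_map (continuous_contr q₁ q₂ i).measurable.aemeasurable
      (Continuous.aestronglyMeasurable (by fun_prop)), charFun_apply, ← integral_const_mul]
    refine integral_congr_ae (ae_of_all _ fun x => ?_)
    simp only [contr]
    rw [← Complex.exp_add, map_add, inner_add_left, hsymm x]
    congr 1
    push_cast
    ring
  conv_lhs => rw [charFun_apply, hsum]
  rw [integral_smul_measure, integral_finsetSum_measure fun i _ => by
    have := hprob i; exact hint _]
  simp only [hi, ← Finset.sum_mul]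
  simp [mul_assoc]

/-- A Borel probability measure that satisfies the invariance equation is `μ_{A,𝒟}`. -/
theorem eq_sierpinskiMeasure {q₁ q₂ : ℤ} (h₁ : 1 ≤ q₁) (h₂ : 1 ≤ q₂) (ν : Measure Plane)
    [IsProbabilityMeasure ν]
    (hν : ∀ E, MeasurableSet E → ν E =
      3⁻¹ * ∑ i, ν ((fun x => Matrix.toEuclideanLin (matA q₁ q₂) x - digit i) '' E)) :
    ν = sierpinskiMeasure q₁ q₂ := by
  have := isProbabilityMeasure_sierpinskiMeasure h₁ h₂
  have hcont : ∀ (m : Measure Plane) [IsProbabilityMeasure m], Continuous (charFun m) := by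
    intro m _
    refine continuous_of_dominated (bound := fun _ => 1)
      (F := fun t x => Complex.exp (⟪x, t⟫_ℝ * Complex.I)) (fun t => ?_) (fun t => ?_)
      (integrable_const 1) (ae_of_all _ fun x => by fun_prop)
    · exact Continuous.aestronglyMeasurable (by fun_prop)
    · exact ae_of_all _ fun x => (Complex.norm_exp_ofReal_mul_I _).le
  refine Measure.ext_of_charFun (funext fun t => ?_)
  set T : Plane → Plane := fun x => Matrix.toEuclideanLin (matA q₁ q₂)⁻¹ x with hT
  set D : Plane → ℝ := fun s => ‖charFun ν s - charFun (sierpinskiMeasure q₁ q₂) s‖ with hD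
  have hstep : ∀ s, D s ≤ D (T s) := by
    intro s
    simp only [hD]
    rw [charFun_eq_of_invariant h₁ h₂ ν hν s, charFun_eq_of_invariant h₁ h₂ _
      (fun E hE => sierpinskiMeasure_apply h₁ h₂ hE) s, ← mul_sub, norm_mul]
    refine mul_le_of_le_one_left (norm_nonneg _) ?_
    rw [norm_mul]
    calc _ ≤ ‖(1 / 3 : ℂ)‖ * ∑ i : Fin 3, (1 : ℝ) := by
          gcongr
          refine norm_sum_le_of_le _ fun i _ => (Complex.norm_exp_ofReal_mul_I _).le
      _ = 1 := by norm_num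
  have hiter : ∀ n, D t ≤ D (T^[n] t) := by
    intro n
    induction n with
    | zero => simp
    | succ n ih => rw [Function.iterate_succ_apply']; exact ih.trans (hstep _)
  have hnorm : ∀ n, ‖T^[n] t‖ ≤ (1 / 3) ^ n * ‖t‖ := by
    intro n
    induction n with
    | zero => simp
    | succ n ih =>
      rw [Function.iterate_succ_apply']
      calc _ ≤ 1 / 3 * ‖T^[n] t‖ := norm_inv_le h₁ h₂ _
        _ ≤ 1 / 3 * ((1 / 3) ^ n * ‖t‖) := by gcongr
        _ = _ := by ring
  have hlim : Tendsto (fun n => T^[n] t) atTop (𝓝 0) := by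
    refine squeeze_zero_norm hnorm ?_
    simpa using (tendsto_pow_atTop_nhds_zero_of_lt_one (r := (1 / 3 : ℝ)) (by norm_num)
      (by norm_num)).mul_const ‖t‖
  have hDc : Continuous D := ((hcont ν).sub (hcont (sierpinskiMeasure q₁ q₂))).norm
  have hD0 : Tendsto (fun n => D (T^[n] t)) atTop (𝓝 0) := by
    have := (hDc.tendsto 0).comp hlim
    simpa [hD, Function.comp_def] using this
  have : D t ≤ 0 := ge_of_tendsto' hD0 hiter
  exact sub_eq_zero.1 (norm_le_zero_iff.1 this)

end Sierpinski

/-! Write s = log 3 / log(3q₂).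

Upper bound. The Fourier transform of μ is the infinite product of the factors `mask`(A⁻ʲt)/3. A
zero of 1 + e^{it₀} + e^{it₁} stays away from the line t₁ = 0, so two orthogonal frequencies at
distance d annihilate a factor whose index j satisfies (3q₂)ʲ ≤ 8d (`exists_mask_eq_zero_of_inner`).
Inside a ball of radius h only the first n factors can be responsible, where (3q₂)ⁿ is comparable to
h. The frequencies in the ball are therefore already orthogonal on the n-th discrete approximation,
a space of dimension 3ⁿ, which bounds their number by a multiple of hˢ
(`encard_le_of_isOrthogonalSet`).

Lower bound. The cell of level n at the origin has mass 3⁻ⁿ and carries a copy of μ scaled by A⁻ⁿ,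
so Parseval for its indicator says that the squares |μ̂(A⁻ⁿλ)|², λ ∈ Λ, sum to 3ⁿ. If n is a
multiple of p, every A⁻ⁿλ lies within a fixed R of some γ ∈ Λ. The perturbed Bessel inequality
`sum_norm_sq_inner_expLp_le` bounds the sum by a constant times the largest number of λ that share a
γ. Hence some γ is shared by at least a constant times 3ⁿ frequencies, all in a ball of radius
comparable to (3q₂)ⁿ, because 3q₂ is the larger expansion rate of A. Thus the density at exponent s
is positive. -/

namespace Sierpinski

/-! ### Coordinates of A⁻ⁿ and inner products of exponentials -/

/-- The linear contraction `x ↦ A⁻ⁿ x`. -/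
noncomputable def invPow (q₁ q₂ : ℤ) (n : ℕ) : Plane →ₗ[ℝ] Plane :=
  Matrix.toEuclideanLin ((matA q₁ q₂)⁻¹ ^ n)

theorem invPow_apply_zero {q₁ q₂ : ℤ} (h₁ : 1 ≤ q₁) (h₂ : 1 ≤ q₂) (n : ℕ) (x : Plane) :
    invPow q₁ q₂ n x 0 = (3 * (q₁ : ℝ))⁻¹ ^ n * x 0 := by
  rw [invPow, matA_inv h₁ h₂, Matrix.diagonal_pow]
  simp [Matrix.toLpLin_apply]

theorem invPow_apply_one {q₁ q₂ : ℤ} (h₁ : 1 ≤ q₁) (h₂ : 1 ≤ q₂) (n : ℕ) (x : Plane) :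
    invPow q₁ q₂ n x 1 = (3 * (q₂ : ℝ))⁻¹ ^ n * x 1 := by
  rw [invPow, matA_inv h₁ h₂, Matrix.diagonal_pow]
  simp [Matrix.toLpLin_apply]

theorem plane_ext {x y : Plane} (h0 : x 0 = y 0) (h1 : x 1 = y 1) : x = y := by
  ext i
  fin_cases i
  exacts [h0, h1]

theorem inner_plane (x y : Plane) : ⟪x, y⟫_ℝ = x 0 * y 0 + x 1 * y 1 := by
  simp [PiLp.inner_apply, Fin.sum_univ_two, mul_comm]

theorem invPow_add {q₁ q₂ : ℤ} (m n : ℕ) (x : Plane) :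
    invPow q₁ q₂ (m + n) x = invPow q₁ q₂ m (invPow q₁ q₂ n x) := by
  simp [invPow, pow_add]

theorem invPow_zero (q₁ q₂ : ℤ) (x : Plane) : invPow q₁ q₂ 0 x = x := by
  simp [invPow]

theorem norm_invPow_le {q₁ q₂ : ℤ} (h₁ : 1 ≤ q₁) (h₂ : 1 ≤ q₂) (n : ℕ) (x : Plane) :
    ‖invPow q₁ q₂ n x‖ ≤ (1 / 3) ^ n * ‖x‖ :=
  norm_inv_pow_le h₁ h₂ n x

theorem inner_invPow {q₁ q₂ : ℤ} (h₁ : 1 ≤ q₁) (h₂ : 1 ≤ q₂) (n : ℕ) (x y : Plane) :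
    ⟪invPow q₁ q₂ n x, y⟫_ℝ = ⟪x, invPow q₁ q₂ n y⟫_ℝ := by
  rw [inner_plane, inner_plane, invPow_apply_zero h₁ h₂, invPow_apply_zero h₁ h₂,
    invPow_apply_one h₁ h₂, invPow_apply_one h₁ h₂]
  ring

theorem continuous_expFun (l : Plane) : Continuous (expFun l) := by
  unfold expFun; fun_prop

theorem star_expFun (l x : Plane) : (starRingEnd ℂ) (expFun l x) = expFun (-l) x := by
  rw [expFun, expFun, ← Complex.exp_conj]
  simp [inner_neg_left, Complex.conj_ofNat]

theorem expFun_add (l m x : Plane) : expFun (l + m) x = expFun l x * expFun m x := by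
  rw [expFun, expFun, expFun, ← Complex.exp_add, inner_add_left]
  push_cast
  ring_nf

theorem inner_expLp (μ : Measure Plane) [IsFiniteMeasure μ] (l : Plane) {f : Plane → ℂ}
    (hf : MemLp f 2 μ) : ⟪expLp μ l, hf.toLp f⟫_ℂ = ∫ x, expFun (-l) x * f x ∂μ := by
  rw [L2.inner_def]
  refine integral_congr_ae ?_
  filter_upwards [(memLp_expFun μ l).coeFn_toLp, hf.coeFn_toLp] with x h1 h2
  rw [expLp, h1, h2, RCLike.inner_apply, star_expFun, mul_comm]

/-- The inner product conjugates its first argument and `charFun` uses the kernel e^{i⟨x,t⟩}, whence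
the sign l - m and the factor 2π. -/
theorem inner_expLp_expLp (μ : Measure Plane) [IsFiniteMeasure μ] (l m : Plane) :
    ⟪expLp μ l, expLp μ m⟫_ℂ = charFun μ ((2 * Real.pi) • (l - m)) := by
  rw [expLp, expLp, ← expLp, inner_expLp, charFun_apply]
  refine integral_congr_ae (ae_of_all _ fun x => ?_)
  simp only [expFun, ← Complex.exp_add]
  congr 1
  rw [inner_smul_right, inner_neg_left, inner_sub_right, real_inner_comm x l, real_inner_comm x m]
  push_cast
  ring

/-! ### Zeros of the Fourier transform -/

/-- The trigonometric polynomial of the digit set. -/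
noncomputable def mask (t : Plane) : ℂ := ∑ i, Complex.exp (⟪digit i, t⟫_ℝ * Complex.I)

theorem charFun_sierpinskiMeasure {q₁ q₂ : ℤ} (h₁ : 1 ≤ q₁) (h₂ : 1 ≤ q₂) (t : Plane) :
    charFun (sierpinskiMeasure q₁ q₂) t =
      1 / 3 * mask (invPow q₁ q₂ 1 t) * charFun (sierpinskiMeasure q₁ q₂) (invPow q₁ q₂ 1 t) := by
  have := isProbabilityMeasure_sierpinskiMeasure h₁ h₂
  rw [charFun_eq_of_invariant h₁ h₂ _ (fun E hE => sierpinskiMeasure_apply h₁ h₂ hE) t, mask]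
  have h : Matrix.toEuclideanLin (matA q₁ q₂)⁻¹ = invPow q₁ q₂ 1 := by rw [invPow, pow_one]
  simp only [h, inner_invPow h₁ h₂]

/-- Since e^{it₀} = -1 - e^{it₁} has modulus one, cos t₁ = -1/2, while cos u ≥ 1 - u²/2 > 1/2 when
|u| < 1. The second coordinate is the one that A contracts by 3q₂. -/
theorem one_le_abs_of_mask_eq_zero {t : Plane} (h : mask t = 0) : 1 ≤ |t 1| := by
  have hm : mask t = 1 + Complex.exp (t 0 * Complex.I) + Complex.exp (t 1 * Complex.I) := by
    simp [mask, Fin.sum_univ_three, digit, inner_plane]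
  rw [hm] at h
  have hre := congrArg Complex.re h
  have him := congrArg Complex.im h
  simp only [Complex.add_re, Complex.add_im, Complex.one_re, Complex.one_im,
    Complex.exp_ofReal_mul_I_re, Complex.exp_ofReal_mul_I_im, Complex.zero_re,
    Complex.zero_im] at hre him
  have hc : Real.cos (t 1) = -1 / 2 := by
    have ha := Real.sin_sq_add_cos_sq (t 0)
    have hb := Real.sin_sq_add_cos_sq (t 1)
    have e1 : Real.cos (t 0) = -1 - Real.cos (t 1) := by linarith
    have e2 : Real.sin (t 0) = -Real.sin (t 1) := by linarith
    rw [e1, e2] at ha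
    linarith
  by_contra! hlt
  have := Real.one_sub_sq_div_two_le_cos (x := t 1)
  have := abs_lt.1 hlt
  nlinarith

/-- If no factor vanished, the zero at t would propagate to every A⁻ⁿt. These points tend to 0,
where the continuous function `charFun` equals 1. -/
theorem exists_mask_eq_zero {q₁ q₂ : ℤ} (h₁ : 1 ≤ q₁) (h₂ : 1 ≤ q₂) {t : Plane}
    (h : charFun (sierpinskiMeasure q₁ q₂) t = 0) : ∃ j, mask (invPow q₁ q₂ (j + 1) t) = 0 := by
  have := isProbabilityMeasure_sierpinskiMeasure h₁ h₂
  by_contra! hne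
  have hz : ∀ n, charFun (sierpinskiMeasure q₁ q₂) (invPow q₁ q₂ n t) = 0 := by
    intro n
    induction n with
    | zero => rwa [invPow_zero]
    | succ n ih =>
      rw [charFun_sierpinskiMeasure h₁ h₂, ← invPow_add, add_comm 1 n] at ih
      simpa [hne n] using ih
  have hlim : Tendsto (fun n => invPow q₁ q₂ n t) atTop (𝓝 0) := by
    refine squeeze_zero_norm (norm_invPow_le h₁ h₂ · t) ?_
    simpa using (tendsto_pow_atTop_nhds_zero_of_lt_one (r := (1 / 3 : ℝ)) (by norm_num)
      (by norm_num)).mul_const ‖t‖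
  have hc := (continuous_charFun (μ := sierpinskiMeasure q₁ q₂)).tendsto 0 |>.comp hlim
  simp only [Function.comp_def, hz, charFun_zero] at hc
  have := tendsto_nhds_unique hc tendsto_const_nhds
  simp at this

/-- Two orthogonal frequencies differ, up to the factor `2π`, by a zero of some dilated mask
whose index is controlled by their distance. -/
theorem exists_mask_eq_zero_of_inner {q₁ q₂ : ℤ} (h₁ : 1 ≤ q₁) (h₂ : 1 ≤ q₂) {l m : Plane}
    (h : ⟪expLp (sierpinskiMeasure q₁ q₂) l, expLp (sierpinskiMeasure q₁ q₂) m⟫_ℂ = 0) :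
    ∃ j, mask (invPow q₁ q₂ (j + 1) ((2 * Real.pi) • (l - m))) = 0 ∧
      (3 * (q₂ : ℝ)) ^ (j + 1) ≤ 8 * dist l m := by
  rw [inner_expLp_expLp] at h
  obtain ⟨j, hj⟩ := exists_mask_eq_zero h₁ h₂ h
  refine ⟨j, hj, ?_⟩
  have hq : (0 : ℝ) < 3 * q₂ := by
    have : (1 : ℝ) ≤ q₂ := by exact_mod_cast h₂
    linarith
  have h1 := one_le_abs_of_mask_eq_zero hj
  rw [invPow_apply_one h₁ h₂, abs_mul, abs_of_pos (by positivity : 0 < (3 * (q₂ : ℝ))⁻¹ ^ (j + 1)),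
    inv_pow, inv_mul_eq_div, one_le_div (by positivity)] at h1
  refine h1.trans ?_
  have h2 : |((2 * Real.pi) • (l - m)) 1| = 2 * Real.pi * |(l - m) 1| := by
    rw [PiLp.smul_apply, smul_eq_mul, abs_mul, abs_of_pos (by positivity)]
  have h3 : |(l - m) 1| ≤ dist l m := by
    rw [dist_eq_norm]
    exact PiLp.norm_apply_le (l - m) 1
  rw [h2]
  -- The constant 8 absorbs the factor 2π.
  have := Real.pi_lt_four
  nlinarith [abs_nonneg ((l - m) 1), Real.pi_pos]

/-! ### Counting orthogonal frequencies -/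

/-- The exponential with frequency `l` on the `n`-th discrete approximation of the measure. -/
noncomputable def discreteExp (q₁ q₂ : ℤ) (n : ℕ) (l : Plane) :
    EuclideanSpace ℂ (Fin n → Fin 3) :=
  WithLp.toLp 2 fun ω => ∏ j : Fin n,
    Complex.exp (⟪digit (ω j), invPow q₁ q₂ (j + 1) ((2 * Real.pi) • l)⟫_ℝ * Complex.I)

/-- The phase of a digit word is a sum over positions, so the sum over words factors into one mask
per position. -/
theorem inner_discreteExp (q₁ q₂ : ℤ) (n : ℕ) (l m : Plane) :
    ⟪discreteExp q₁ q₂ n l, discreteExp q₁ q₂ n m⟫_ℂ =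
      ∏ j : Fin n, mask (invPow q₁ q₂ (j + 1) ((2 * Real.pi) • (m - l))) := by
  simp only [mask]
  rw [Finset.prod_univ_sum, Fintype.piFinset_univ, PiLp.inner_apply]
  refine Finset.sum_congr rfl fun ω _ => ?_
  simp only [discreteExp, RCLike.inner_apply, map_prod, ← Finset.prod_mul_distrib]
  refine Finset.prod_congr rfl fun j _ => ?_
  rw [← Complex.exp_conj, ← Complex.exp_add]
  congr 1
  rw [smul_sub, map_sub, inner_sub_right]
  simp
  ring

theorem discreteExp_ne_zero (q₁ q₂ : ℤ) (n : ℕ) (l : Plane) : discreteExp q₁ q₂ n l ≠ 0 := by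
  intro h
  have := congrArg (fun v : EuclideanSpace ℂ (Fin n → Fin 3) => v 0) h
  simp [discreteExp, Finset.prod_eq_zero_iff] at this

/-- The choice of n forces the vanishing mask of each pair to be among the first n. The vectors
`discreteExp` are then nonzero and pairwise orthogonal in dimension 3ⁿ. -/
theorem encard_le_of_isOrthogonalSet {q₁ q₂ : ℤ} (h₁ : 1 ≤ q₁) (h₂ : 1 ≤ q₂) {S : Set Plane}
    (hS : IsOrthogonalSet (sierpinskiMeasure q₁ q₂) S) {d : ℝ}
    (hd : ∀ l ∈ S, ∀ m ∈ S, dist l m ≤ d) {n : ℕ} (hn : 8 * d < (3 * (q₂ : ℝ)) ^ (n + 1)) :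
    S.encard ≤ (3 ^ n : ℕ) := by
  have hq : (1 : ℝ) < 3 * q₂ := by
    have : (1 : ℝ) ≤ q₂ := by exact_mod_cast h₂
    linarith
  have hli : LinearIndepOn ℂ (discreteExp q₁ q₂ n) S := by
    refine linearIndependent_of_ne_zero_of_inner_eq_zero (fun l => discreteExp_ne_zero _ _ _ _) ?_
    intro l m hlm
    -- The pair is taken in the order m, l because `inner_discreteExp` evaluates the masks at m - l.
    obtain ⟨j, hj, hjd⟩ := exists_mask_eq_zero_of_inner h₁ h₂
      (hS m.2 l.2 fun h => hlm (Subtype.ext h.symm))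
    have hjn : j + 1 < n + 1 := by
      refine (pow_lt_pow_iff_right₀ hq).1 ?_
      linarith [hd m m.2 l l.2]
    have hj' : j < n := by omega
    rw [inner_discreteExp, Finset.prod_eq_zero_iff]
    exact ⟨⟨j, hj'⟩, Finset.mem_univ _, hj⟩
  have hrank := hli.encard_le_toENat_rank
  rw [← Module.finrank_eq_rank, finrank_euclideanSpace] at hrank
  simpa using hrank

/-! ### Upper bound for the density and the dimension -/

theorem three_pow_eq_rpow {b : ℝ} (hb : 1 < b) (n : ℕ) :
    (3 : ℝ) ^ n = (b ^ n) ^ (Real.log 3 / Real.log b) := by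
  have h3 : b ^ (Real.log 3 / Real.log b) = 3 :=
    Real.rpow_logb (by linarith) hb.ne' (by norm_num)
  rw [← Real.rpow_natCast b, ← Real.rpow_mul (by linarith), mul_comm, Real.rpow_mul (by linarith),
    h3, Real.rpow_natCast]

theorem one_lt_three_mul_cast {q : ℤ} (hq : 1 ≤ q) : (1 : ℝ) < 3 * q := by
  have : (1 : ℝ) ≤ q := by exact_mod_cast hq
  linarith

theorem encard_inter_ball_le {q₁ q₂ : ℤ} (h₁ : 1 ≤ q₁) (h₂ : 1 ≤ q₂) {Λ : Set Plane}
    (hΛ : IsOrthogonalSet (sierpinskiMeasure q₁ q₂) Λ) (x : Plane) {h : ℝ} (hh : 1 ≤ h) :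
    ((Λ ∩ Metric.ball x h).encard : ℝ≥0∞) ≤
      ENNReal.ofReal ((16 * h) ^ (Real.log 3 / Real.log (3 * (q₂ : ℝ)))) := by
  have hb := one_lt_three_mul_cast h₂
  -- Here 16h = 8 · 2h, with 2h bounding the distances inside the ball.
  obtain ⟨n, hn, hn'⟩ := exists_nat_pow_near (show 1 ≤ 16 * h by linarith) hb
  have hcard : (Λ ∩ Metric.ball x h).encard ≤ (3 ^ n : ℕ) := by
    refine encard_le_of_isOrthogonalSet h₁ h₂ (hΛ.mono Set.inter_subset_left) (d := 2 * h)
      (fun l hl m hm => ?_) (by linarith)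
    have h1 := Metric.mem_ball.1 hl.2
    have h2 := Metric.mem_ball.1 hm.2
    linarith [dist_triangle_right l m x]
  calc ((Λ ∩ Metric.ball x h).encard : ℝ≥0∞) ≤ (((3 ^ n : ℕ) : ℕ∞) : ℝ≥0∞) := by
        exact_mod_cast hcard
    _ = ENNReal.ofReal (3 ^ n) := by
        rw [ENNReal.ofReal_pow (by norm_num)]
        norm_num
    _ ≤ _ := by
        refine ENNReal.ofReal_le_ofReal ?_
        rw [three_pow_eq_rpow hb]
        exact Real.rpow_le_rpow (by positivity) hn
          (div_nonneg (Real.log_nonneg (by norm_num)) (Real.log_nonneg hb.le))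

/-- Dividing the count (16h)ˢ by hʳ leaves 16ˢ h^{-(r-s)}, which tends to 0. -/
theorem upperBeurlingDensity_eq_zero {q₁ q₂ : ℤ} (h₁ : 1 ≤ q₁) (h₂ : 1 ≤ q₂) {Λ : Set Plane}
    (hΛ : IsOrthogonalSet (sierpinskiMeasure q₁ q₂) Λ) {r : ℝ}
    (hr : Real.log 3 / Real.log (3 * (q₂ : ℝ)) < r) : upperBeurlingDensity r Λ = 0 := by
  set s := Real.log 3 / Real.log (3 * (q₂ : ℝ)) with hs
  have hlim : Tendsto (fun h : ℝ => ENNReal.ofReal (16 ^ s * h ^ (-(r - s)))) atTop (𝓝 0) := by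
    have := (tendsto_rpow_neg_atTop (sub_pos.2 hr)).const_mul ((16 : ℝ) ^ s)
    simpa using ENNReal.tendsto_ofReal this
  refine le_antisymm ?_ zero_le
  rw [← hlim.limsup_eq]
  refine limsup_le_limsup ?_
  filter_upwards [eventually_ge_atTop 1] with h hh
  have h0 : 0 < h := by linarith
  refine iSup_le fun x => ?_
  rw [ENNReal.div_le_iff (by simpa using Real.rpow_pos_of_pos h0 r) ENNReal.ofReal_ne_top,
    ← ENNReal.ofReal_mul (by positivity)]
  refine (encard_inter_ball_le h₁ h₂ hΛ x hh).trans (ENNReal.ofReal_le_ofReal (le_of_eq ?_))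
  rw [← hs, Real.mul_rpow (by norm_num) h0.le, mul_assoc, ← Real.rpow_add h0]
  ring_nf

theorem beurlingDim_le {q₁ q₂ : ℤ} (h₁ : 1 ≤ q₁) (h₂ : 1 ≤ q₂) {Λ : Set Plane}
    (hΛ : IsOrthogonalSet (sierpinskiMeasure q₁ q₂) Λ) :
    beurlingDim Λ ≤ ENNReal.ofReal (Real.log 3 / Real.log (3 * (q₂ : ℝ))) := by
  have hs : 0 < Real.log 3 / Real.log (3 * (q₂ : ℝ)) :=
    div_pos (Real.log_pos (by norm_num)) (Real.log_pos (one_lt_three_mul_cast h₂))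
  set s := Real.log 3 / Real.log (3 * (q₂ : ℝ)) with hs'
  -- The density at s itself need not vanish, so s is only approached from the right.
  have hle : ∀ r, s < r → beurlingDim Λ ≤ ENNReal.ofReal r := fun r hr =>
    iInf_le_of_le r (iInf_le_of_le (hs.trans hr)
      (iInf_le_of_le (upperBeurlingDensity_eq_zero h₁ h₂ hΛ hr) le_rfl))
  have hlim : Tendsto ENNReal.ofReal (𝓝[>] s) (𝓝 (ENNReal.ofReal s)) :=
    ENNReal.continuous_ofReal.continuousAt.tendsto.mono_left nhdsWithin_le_nhds
  exact ge_of_tendsto hlim (eventually_nhdsWithin_of_forall hle)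

/-! ### Restriction of the measure to a cylinder -/

theorem norm_series_le {q₁ q₂ : ℤ} (h₁ : 1 ≤ q₁) (h₂ : 1 ≤ q₂) (ω : ℕ → Fin 3) :
    ‖series q₁ q₂ ω‖ ≤ 1 / 2 := by
  have hg : HasSum (fun j : ℕ => ((1 : ℝ) / 3) ^ (j + 1)) (1 / 2) := by
    have := (hasSum_geometric_of_lt_one (r := (1 / 3 : ℝ)) (by norm_num) (by norm_num)).mul_right
      (1 / 3)
    norm_num at this
    simpa [pow_succ] using this
  exact tsum_of_norm_bounded hg fun j => norm_term_le h₁ h₂ j (ω j)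

theorem digit_apply_nonneg (i : Fin 3) (k : Fin 2) : 0 ≤ digit i k := by
  fin_cases i <;> fin_cases k <;> simp [digit]

theorem series_apply_nonneg {q₁ q₂ : ℤ} (h₁ : 1 ≤ q₁) (h₂ : 1 ≤ q₂) (ω : ℕ → Fin 3) (k : Fin 2) :
    0 ≤ series q₁ q₂ ω k := by
  have hc := (EuclideanSpace.proj (𝕜 := ℝ) k).map_tsum (summable_series h₁ h₂ ω)
  rw [series]
  refine le_of_le_of_eq (tsum_nonneg fun j => ?_) hc.symm
  have hb₁ := one_lt_three_mul_cast h₁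
  have hb₂ := one_lt_three_mul_cast h₂
  have h := digit_apply_nonneg (ω j)
  change 0 ≤ invPow q₁ q₂ (j + 1) (digit (ω j)) k
  fin_cases k
  · exact (mul_nonneg (by positivity) (h 0)).trans_eq (invPow_apply_zero h₁ h₂ _ _).symm
  · exact (mul_nonneg (by positivity) (h 1)).trans_eq (invPow_apply_one h₁ h₂ _ _).symm

theorem ae_sierpinskiMeasure {q₁ q₂ : ℤ} (h₁ : 1 ≤ q₁) (h₂ : 1 ≤ q₂) :
    ∀ᵐ x ∂(sierpinskiMeasure q₁ q₂), ‖x‖ ≤ 1 / 2 ∧ 0 ≤ x 0 ∧ 0 ≤ x 1 := by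
  rw [sierpinskiMeasure, ae_map_iff (continuous_series h₁ h₂).measurable.aemeasurable]
  · exact ae_of_all _ fun ω => ⟨norm_series_le h₁ h₂ ω, series_apply_nonneg h₁ h₂ ω 0,
      series_apply_nonneg h₁ h₂ ω 1⟩
  · have hm : ∀ k : Fin 2, MeasurableSet {x : Plane | 0 ≤ x k} := fun k =>
      measurableSet_le measurable_const (by fun_prop)
    have hn : MeasurableSet {x : Plane | ‖x‖ ≤ 1 / 2} :=
      measurableSet_le measurable_norm measurable_const
    exact hn.inter ((hm 0).inter (hm 1))

/-- The open cell at the origin which contains exactly the points of the attractor whose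
first `n` digits vanish. -/
def cell (q₁ q₂ : ℤ) (n : ℕ) : Set Plane :=
  {x | x 0 < (3 * (q₁ : ℝ))⁻¹ ^ n} ∩ {x | x 1 < (3 * (q₂ : ℝ))⁻¹ ^ n}

theorem measurableSet_cell (q₁ q₂ : ℤ) (n : ℕ) : MeasurableSet (cell q₁ q₂ n) := by
  refine IsOpen.measurableSet ?_
  refine (isOpen_lt ?_ continuous_const).inter (isOpen_lt ?_ continuous_const) <;> fun_prop

theorem continuous_invPow (q₁ q₂ : ℤ) (n : ℕ) : Continuous (invPow q₁ q₂ n) :=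
  LinearMap.continuous_of_finiteDimensional _

theorem contr_eq_invPow (q₁ q₂ : ℤ) (i : Fin 3) (x : Plane) :
    contr q₁ q₂ i x = invPow q₁ q₂ 1 (x + digit i) := by
  rw [contr, invPow, pow_one]

theorem contr_mem_cell_succ {q₁ q₂ : ℤ} (h₁ : 1 ≤ q₁) (h₂ : 1 ≤ q₂) (i : Fin 3) (n : ℕ)
    (x : Plane) : contr q₁ q₂ i x ∈ cell q₁ q₂ (n + 1) ↔ x + digit i ∈ cell q₁ q₂ n := by
  have hb₁ : 0 < (3 * (q₁ : ℝ))⁻¹ := inv_pos.2 (by linarith [one_lt_three_mul_cast h₁])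
  have hb₂ : 0 < (3 * (q₂ : ℝ))⁻¹ := inv_pos.2 (by linarith [one_lt_three_mul_cast h₂])
  simp only [cell, Set.mem_inter_iff, Set.mem_ofPred_eq, contr_eq_invPow,
    invPow_apply_zero h₁ h₂, invPow_apply_one h₁ h₂, pow_one, pow_succ' _ n,
    mul_lt_mul_iff_right₀ hb₁, mul_lt_mul_iff_right₀ hb₂]

/-- In the invariance equation a nonzero digit moves one coordinate to at least 1, outside the cell,
because μ lives on the nonnegative quadrant. Only the zero digit contributes. -/
theorem measure_cell_inter_succ {q₁ q₂ : ℤ} (h₁ : 1 ≤ q₁) (h₂ : 1 ≤ q₂) (n : ℕ) {E : Set Plane}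
    (hE : MeasurableSet E) :
    sierpinskiMeasure q₁ q₂ (E ∩ cell q₁ q₂ (n + 1)) =
      3⁻¹ * sierpinskiMeasure q₁ q₂ (invPow q₁ q₂ 1 ⁻¹' E ∩ cell q₁ q₂ n) := by
  rw [sierpinskiMeasure_apply h₁ h₂ (hE.inter (measurableSet_cell _ _ _))]
  simp only [image_eq_preimage h₁ h₂]
  have hb₁ : (3 * (q₁ : ℝ))⁻¹ ^ n ≤ 1 :=
    pow_le_one₀ (by positivity) (inv_le_one_of_one_le₀ (one_lt_three_mul_cast h₁).le)
  have hb₂ : (3 * (q₂ : ℝ))⁻¹ ^ n ≤ 1 :=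
    pow_le_one₀ (by positivity) (inv_le_one_of_one_le₀ (one_lt_three_mul_cast h₂).le)
  rw [Fin.sum_univ_three]
  have hz : contr q₁ q₂ 0 ⁻¹' (E ∩ cell q₁ q₂ (n + 1)) = invPow q₁ q₂ 1 ⁻¹' E ∩ cell q₁ q₂ n := by
    have hd : digit 0 = 0 := plane_ext (by simp [digit]) (by simp [digit])
    ext x
    rw [Set.mem_preimage, Set.mem_inter_iff, contr_mem_cell_succ h₁ h₂, contr_eq_invPow, hd,
      add_zero]
    rfl
  have h01 : sierpinskiMeasure q₁ q₂ (contr q₁ q₂ 1 ⁻¹' (E ∩ cell q₁ q₂ (n + 1))) = 0 := by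
    refine measure_eq_zero_iff_ae_notMem.2 ?_
    filter_upwards [ae_sierpinskiMeasure h₁ h₂] with x hx hmem
    have hlt : x 0 + digit 1 0 < _ := ((contr_mem_cell_succ h₁ h₂ 1 n x).1 hmem.2).1
    have hd : digit 1 0 = 1 := by simp [digit]
    linarith [hx.2.1]
  have h02 : sierpinskiMeasure q₁ q₂ (contr q₁ q₂ 2 ⁻¹' (E ∩ cell q₁ q₂ (n + 1))) = 0 := by
    refine measure_eq_zero_iff_ae_notMem.2 ?_
    filter_upwards [ae_sierpinskiMeasure h₁ h₂] with x hx hmem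
    have hlt : x 1 + digit 2 1 < _ := ((contr_mem_cell_succ h₁ h₂ 2 n x).1 hmem.2).2
    have hd : digit 2 1 = 1 := by simp [digit]
    linarith [hx.2.2]
  rw [hz, h01, h02, add_zero, add_zero]

theorem measure_cell_inter {q₁ q₂ : ℤ} (h₁ : 1 ≤ q₁) (h₂ : 1 ≤ q₂) (n : ℕ) {E : Set Plane}
    (hE : MeasurableSet E) :
    sierpinskiMeasure q₁ q₂ (E ∩ cell q₁ q₂ n) =
      3⁻¹ ^ n * sierpinskiMeasure q₁ q₂ (invPow q₁ q₂ n ⁻¹' E) := by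
  induction n generalizing E with
  | zero =>
    rw [pow_zero, one_mul]
    refine measure_congr ?_
    filter_upwards [ae_sierpinskiMeasure h₁ h₂] with x hx
    refine propext ?_
    have h0 := (PiLp.norm_apply_le x 0).trans hx.1
    have h1 := (PiLp.norm_apply_le x 1).trans hx.1
    have h0' := (abs_le.1 h0).2
    have h1' := (abs_le.1 h1).2
    -- At level 0 the cell is given by both coordinates being less than 1, and the support has norm
    -- at most 1/2.
    have : x ∈ cell q₁ q₂ 0 := by
      constructor <;> simp <;> linarith
    change x ∈ E ∩ cell q₁ q₂ 0 ↔ invPow q₁ q₂ 0 x ∈ E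
    rw [invPow_zero]
    exact and_iff_left this
  | succ n ih =>
    rw [measure_cell_inter_succ h₁ h₂ n hE, ih ((continuous_invPow _ _ _).measurable hE),
      pow_succ', mul_assoc]
    congr 3
    ext x
    simp only [Set.mem_preimage, ← invPow_add, add_comm]

/-- Turns the Fourier coefficients of the indicator of a cell into values of the transform of μ at
A⁻ⁿl. -/
theorem restrict_cell {q₁ q₂ : ℤ} (h₁ : 1 ≤ q₁) (h₂ : 1 ≤ q₂) (n : ℕ) :
    (sierpinskiMeasure q₁ q₂).restrict (cell q₁ q₂ n) =
      (3⁻¹ : ℝ≥0∞) ^ n • (sierpinskiMeasure q₁ q₂).map (invPow q₁ q₂ n) := by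
  ext E hE
  rw [Measure.restrict_apply hE, measure_cell_inter h₁ h₂ n hE, Measure.smul_apply,
    Measure.map_apply (continuous_invPow _ _ _).measurable hE, smul_eq_mul]

theorem measure_cell {q₁ q₂ : ℤ} (h₁ : 1 ≤ q₁) (h₂ : 1 ≤ q₂) (n : ℕ) :
    sierpinskiMeasure q₁ q₂ (cell q₁ q₂ n) = 3⁻¹ ^ n := by
  have := isProbabilityMeasure_sierpinskiMeasure h₁ h₂
  simpa using measure_cell_inter h₁ h₂ n MeasurableSet.univ

/-! ### Taylor expansion of the exponentials in the frequency -/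

/-- The monomial function `x ↦ x₀ᵃ x₁ᵇ`. -/
noncomputable def monomialFun (k : ℕ × ℕ) (x : Plane) : ℂ := (x 0 : ℂ) ^ k.1 * (x 1 : ℂ) ^ k.2

/-- The Taylor coefficients of `y ↦ e ^ (-2 π i ⟨y, x⟩)`. -/
noncomputable def taylorCoeff (y : Plane) (k : ℕ × ℕ) : ℂ :=
  (-2 * Real.pi * Complex.I * (y 0 : ℂ)) ^ k.1 / k.1.factorial *
    ((-2 * Real.pi * Complex.I * (y 1 : ℂ)) ^ k.2 / k.2.factorial)

/-- The majorant of the Taylor coefficients for frequencies of norm at most `R`. -/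
noncomputable def taylorWeight (R : ℝ) (k : ℕ × ℕ) : ℝ :=
  (2 * Real.pi * R) ^ k.1 / k.1.factorial * ((2 * Real.pi * R) ^ k.2 / k.2.factorial)

theorem taylorWeight_nonneg {R : ℝ} (hR : 0 ≤ R) (k : ℕ × ℕ) : 0 ≤ taylorWeight R k := by
  have := Real.pi_pos
  unfold taylorWeight
  positivity

theorem summable_taylorWeight {R : ℝ} (hR : 0 ≤ R) : Summable (taylorWeight R) := by
  have := Real.pi_pos
  have h := Real.summable_pow_div_factorial (2 * Real.pi * R)
  exact h.mul_of_nonneg h (fun n => by positivity) fun n => by positivity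

theorem norm_taylorCoeff_le {R : ℝ} {y : Plane} (hy : ‖y‖ ≤ R) (k : ℕ × ℕ) :
    ‖taylorCoeff y k‖ ≤ taylorWeight R k := by
  have hpi := Real.pi_pos
  have h : ∀ (i : Fin 2) (n : ℕ), ‖(-2 * Real.pi * Complex.I * (y i : ℂ)) ^ n / n.factorial‖ ≤
      (2 * Real.pi * R) ^ n / n.factorial := by
    intro i n
    have hz : ‖-2 * Real.pi * Complex.I * (y i : ℂ)‖ ≤ 2 * Real.pi * R := by
      have := (PiLp.norm_apply_le y i).trans hy
      simp only [norm_mul, norm_neg, Complex.norm_ofNat, Complex.norm_real, Complex.norm_I,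
        mul_one, Real.norm_of_nonneg hpi.le]
      gcongr
    rw [norm_div, norm_pow, Complex.norm_natCast]
    gcongr
  rw [taylorCoeff, norm_mul]
  exact mul_le_mul (h 0 k.1) (h 1 k.2) (norm_nonneg _) ((norm_nonneg _).trans (h 0 k.1))

theorem hasSum_mul_of_summable_norm {f g : ℕ → ℂ} {z w : ℂ} (hf : HasSum f z) (hg : HasSum g w)
    (hf' : Summable fun n => ‖f n‖) (hg' : Summable fun n => ‖g n‖) :
    HasSum (fun k : ℕ × ℕ => f k.1 * g k.2) (z * w) :=
  hf.mul hg (summable_mul_of_summable_norm hf' hg')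

theorem hasSum_pow_div_factorial (z : ℂ) :
    HasSum (fun n : ℕ => z ^ n / (n.factorial : ℂ)) (Complex.exp z) := by
  rw [Complex.exp_eq_exp_ℂ]
  exact NormedSpace.expSeries_div_hasSum_exp z

theorem hasSum_pow_div_factorial_mul (z w : ℂ) :
    HasSum (fun k : ℕ × ℕ => z ^ k.1 / (k.1.factorial : ℂ) * (w ^ k.2 / (k.2.factorial : ℂ)))
      (Complex.exp (z + w)) := by
  rw [Complex.exp_add]
  have h := hasSum_mul_of_summable_norm (hasSum_pow_div_factorial z) (hasSum_pow_div_factorial w)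
    (NormedSpace.norm_expSeries_div_summable z) (NormedSpace.norm_expSeries_div_summable w)
  exact h

theorem hasSum_taylorCoeff_mul_monomialFun (y x : Plane) :
    HasSum (fun k => taylorCoeff y k * monomialFun k x) (expFun y x) := by
  have h := hasSum_pow_div_factorial_mul (-2 * Real.pi * Complex.I * (y 0 : ℂ) * x 0)
    (-2 * Real.pi * Complex.I * (y 1 : ℂ) * x 1)
  have hfun : (fun k => taylorCoeff y k * monomialFun k x) = fun k : ℕ × ℕ =>
      (-2 * Real.pi * Complex.I * (y 0 : ℂ) * x 0) ^ k.1 / k.1.factorial *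
        ((-2 * Real.pi * Complex.I * (y 1 : ℂ) * x 1) ^ k.2 / k.2.factorial) := by
    funext k
    rw [taylorCoeff, monomialFun, mul_pow _ (x 0 : ℂ), mul_pow _ (x 1 : ℂ), div_mul_div_comm,
      div_mul_div_comm, div_mul_eq_mul_div]
    congr 1
    exact mul_mul_mul_comm _ _ _ _
  have hexp : expFun y x = Complex.exp (-2 * Real.pi * Complex.I * (y 0 : ℂ) * x 0 +
      -2 * Real.pi * Complex.I * (y 1 : ℂ) * x 1) := by
    rw [expFun, inner_plane, Complex.ofReal_add, Complex.ofReal_mul, Complex.ofReal_mul, mul_add,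
      mul_assoc _ (y 0 : ℂ), mul_assoc _ (y 1 : ℂ)]
  rw [hfun, hexp]
  exact h

theorem norm_monomialFun_le (k : ℕ × ℕ) {x : Plane} (hx : ‖x‖ ≤ 1) : ‖monomialFun k x‖ ≤ 1 := by
  have h : ∀ i, ‖(x i : ℂ)‖ ≤ 1 := fun i => by
    rw [Complex.norm_real]
    exact (PiLp.norm_apply_le x i).trans hx
  rw [monomialFun, norm_mul, norm_pow, norm_pow]
  exact mul_le_one₀ (pow_le_one₀ (norm_nonneg _) (h 0)) (by positivity)
    (pow_le_one₀ (norm_nonneg _) (h 1))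

theorem continuous_monomialFun (k : ℕ × ℕ) : Continuous (monomialFun k) := by
  unfold monomialFun; fun_prop

/-! ### Perturbed Bessel inequality for exponentials -/

section

variable {μ : Measure Plane} [IsProbabilityMeasure μ]

theorem memLp_monomialFun (hμ : ∀ᵐ x ∂μ, ‖x‖ ≤ 1) (k : ℕ × ℕ) : MemLp (monomialFun k) 2 μ :=
  MemLp.of_bound (continuous_monomialFun k).aestronglyMeasurable 1
    (hμ.mono fun _ hx => norm_monomialFun_le k hx)

theorem norm_toLp_monomialFun_le (hμ : ∀ᵐ x ∂μ, ‖x‖ ≤ 1) (k : ℕ × ℕ) :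
    ‖(memLp_monomialFun hμ k).toLp (monomialFun k)‖ ≤ 1 := by
  refine (Lp.norm_le_of_ae_bound zero_le_one ?_).trans (by simp [measureUnivNNReal])
  filter_upwards [(memLp_monomialFun hμ k).coeFn_toLp, hμ] with x h1 h2
  rw [h1]
  exact norm_monomialFun_le k h2

theorem norm_expLp (l : Plane) : ‖expLp μ l‖ = 1 := by
  have h := inner_expLp_expLp μ l l
  rw [sub_self, smul_zero, charFun_zero, inner_self_eq_norm_sq_to_K] at h
  have h' : ‖expLp μ l‖ ^ 2 = 1 := by
    have := congrArg Complex.re h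
    simpa [← Complex.ofReal_pow] using this
  exact (pow_eq_one_iff_of_nonneg (norm_nonneg _) two_ne_zero).1 h'

/-- Monomials are bounded by 1 on the unit ball and `taylorWeight` is summable, so integration goes
term by term. The expansion separates y, which enters through the coefficients, from l, which enters
through inner products with fixed functions. -/
theorem hasSum_inner_expLp (hμ : ∀ᵐ x ∂μ, ‖x‖ ≤ 1) (l y : Plane) :
    HasSum (fun k => taylorCoeff y k *
        ⟪expLp μ l, (memLp_monomialFun hμ k).toLp (monomialFun k)⟫_ℂ)
      ⟪expLp μ l, expLp μ y⟫_ℂ := by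
  have hbound : ∀ k, ∀ᵐ x ∂μ,
      ‖expFun (-l) x * (taylorCoeff y k * monomialFun k x)‖ ≤ taylorWeight ‖y‖ k := by
    intro k
    filter_upwards [hμ] with x hx
    rw [norm_mul, norm_expFun, one_mul, norm_mul]
    exact (mul_le_of_le_one_right (norm_nonneg _) (norm_monomialFun_le k hx)).trans
      (norm_taylorCoeff_le le_rfl k)
  have hmeas : ∀ k, AEStronglyMeasurable
      (fun x => expFun (-l) x * (taylorCoeff y k * monomialFun k x)) μ := fun k =>
    ((continuous_expFun _).mul
      (continuous_const.mul (continuous_monomialFun k))).aestronglyMeasurable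
  have hint : ∀ k, Integrable (fun x => expFun (-l) x * (taylorCoeff y k * monomialFun k x)) μ :=
    fun k => Integrable.of_bound (hmeas k) _ (hbound k)
  have hsum := hasSum_integral_of_summable_integral_norm hint
    (Summable.of_nonneg_of_le (fun k => integral_nonneg fun x => norm_nonneg _) (fun k => by
      simpa using integral_mono_ae (hint k).norm (integrable_const _) (hbound k))
      (summable_taylorWeight (norm_nonneg y)))
  have hterm : ∀ k, ∫ x, expFun (-l) x * (taylorCoeff y k * monomialFun k x) ∂μ =
      taylorCoeff y k * ⟪expLp μ l, (memLp_monomialFun hμ k).toLp (monomialFun k)⟫_ℂ := by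
    intro k
    rw [inner_expLp, ← integral_const_mul]
    refine integral_congr_ae (ae_of_all _ fun x => ?_)
    ring
  have htotal : ∫ x, ∑' k, expFun (-l) x * (taylorCoeff y k * monomialFun k x) ∂μ =
      ⟪expLp μ l, expLp μ y⟫_ℂ := by
    refine Eq.trans ?_ (inner_expLp μ l (memLp_expFun μ y)).symm
    exact integral_congr_ae (ae_of_all _ fun x =>
      ((hasSum_taylorCoeff_mul_monomialFun y x).mul_left (expFun (-l) x)).tsum_eq)
  simpa only [hterm, htotal] using hsum

/-- Weighted Cauchy–Schwarz: with W, S, Q the three sums, ∑ w (W a - S)² = W (W Q - S²) is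
nonnegative. The case W = 0 is separate. -/
theorem sq_tsum_mul_le {ι : Type*} {w a : ι → ℝ} (hw : Summable w) (hw0 : ∀ k, 0 ≤ w k)
    (hwa : Summable fun k => w k * a k) (hwa2 : Summable fun k => w k * a k ^ 2) :
    (∑' k, w k * a k) ^ 2 ≤ (∑' k, w k) * ∑' k, w k * a k ^ 2 := by
  set W := ∑' k, w k
  set S := ∑' k, w k * a k
  set Q := ∑' k, w k * a k ^ 2
  have hW0 : 0 ≤ W := tsum_nonneg hw0
  have hsum : HasSum (fun k => w k * (W * a k - S) ^ 2)
      (W ^ 2 * Q - 2 * W * S * S + S ^ 2 * W) := by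
    have := ((hwa2.hasSum.mul_left (W ^ 2)).sub (hwa.hasSum.mul_left (2 * W * S))).add
      (hw.hasSum.mul_left (S ^ 2))
    have hfun : (fun k => w k * (W * a k - S) ^ 2) = fun k =>
        W ^ 2 * (w k * a k ^ 2) - 2 * W * S * (w k * a k) + S ^ 2 * w k := by
      funext k
      ring
    rw [hfun]
    exact this
  have h0 : 0 ≤ W * (W * Q - S ^ 2) := by
    have := hsum.nonneg fun k => mul_nonneg (hw0 k) (sq_nonneg _)
    linarith
  rcases hW0.eq_or_lt with h | h
  · have hz : ∀ k, w k = 0 := by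
      have hsw : HasSum w 0 := by
        rw [h]
        exact hw.hasSum
      exact congrFun ((hasSum_zero_iff_of_nonneg hw0).1 hsw)
    have hS : S = 0 := by simp [S, hz]
    rw [← h, hS]
    simp
  · linarith [nonneg_of_mul_nonneg_right h0 h]

/-- Cauchy–Schwarz with the weights `taylorWeight` removes y from the bound except through R, so
that Bessel can afterwards be applied to one monomial at a time. -/
theorem norm_sq_inner_expLp_le (hμ : ∀ᵐ x ∂μ, ‖x‖ ≤ 1) {R : ℝ} (l : Plane) {y : Plane}
    (hy : ‖y‖ ≤ R) :
    ‖⟪expLp μ l, expLp μ y⟫_ℂ‖ ^ 2 ≤ (∑' k, taylorWeight R k) * ∑' k, taylorWeight R k *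
      ‖⟪expLp μ l, (memLp_monomialFun hμ k).toLp (monomialFun k)⟫_ℂ‖ ^ 2 := by
  set a : ℕ × ℕ → ℝ := fun k => ‖⟪expLp μ l, (memLp_monomialFun hμ k).toLp (monomialFun k)⟫_ℂ‖
  have ha : ∀ k, a k ≤ 1 := fun k => by
    refine (norm_inner_le_norm _ _).trans ?_
    rw [norm_expLp, one_mul]
    exact norm_toLp_monomialFun_le hμ k
  have ha0 : ∀ k, 0 ≤ a k := fun k => norm_nonneg _
  have hR : 0 ≤ R := (norm_nonneg y).trans hy
  have hw := summable_taylorWeight hR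
  have hw0 := taylorWeight_nonneg hR
  have hwa : Summable fun k => taylorWeight R k * a k :=
    Summable.of_nonneg_of_le (fun k => mul_nonneg (hw0 k) (ha0 k))
      (fun k => mul_le_of_le_one_right (hw0 k) (ha k)) hw
  have hwa2 : Summable fun k => taylorWeight R k * a k ^ 2 :=
    Summable.of_nonneg_of_le (fun k => mul_nonneg (hw0 k) (sq_nonneg _))
      (fun k => mul_le_of_le_one_right (hw0 k) (pow_le_one₀ (ha0 k) (ha k))) hw
  refine le_trans ?_ (sq_tsum_mul_le hw hw0 hwa hwa2)
  gcongr
  rw [← (hasSum_inner_expLp hμ l y).tsum_eq]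
  refine tsum_of_norm_bounded hwa.hasSum fun k => ?_
  rw [norm_mul]
  exact mul_le_mul_of_nonneg_right (norm_taylorCoeff_le hy k) (norm_nonneg _)

/-- A perturbed Bessel inequality: if `g` maps the index set to an orthonormal family of
exponentials with fibers of at most `M` elements, then the coefficients of exponentials with
bounded frequencies are square summable along `g`, with constant proportional to `M`. -/
theorem sum_norm_sq_inner_expLp_le (hμ : ∀ᵐ x ∂μ, ‖x‖ ≤ 1) {Λ : Set Plane}
    (hΛ : Orthonormal ℂ (fun l : Λ => expLp μ l)) {R : ℝ} (hR : 0 ≤ R) {ι : Type*}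
    (F : Finset ι) (g : ι → Λ) (y : ι → Plane) (hy : ∀ i, ‖y i‖ ≤ R) {M : ℕ}
    (hM : ∀ l, {i | i ∈ F ∧ g i = l}.encard ≤ M) :
    ∑ i ∈ F, ‖⟪expLp μ (g i : Plane), expLp μ (y i)⟫_ℂ‖ ^ 2 ≤
      (∑' k, taylorWeight R k) ^ 2 * M := by
  classical
  set b : Λ → ℕ × ℕ → ℝ := fun l k =>
    ‖⟪expLp μ (l : Plane), (memLp_monomialFun hμ k).toLp (monomialFun k)⟫_ℂ‖ ^ 2
  have hw := summable_taylorWeight hR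
  have hw0 := taylorWeight_nonneg hR
  have hb0 : ∀ l k, 0 ≤ b l k := fun l k => sq_nonneg _
  have hb1 : ∀ s : Finset Λ, ∀ k, ∑ l ∈ s, b l k ≤ 1 := fun s k =>
    (hΛ.sum_inner_products_le _).trans
      (pow_le_one₀ (norm_nonneg _) (norm_toLp_monomialFun_le hμ k))
  have hwb : ∀ l, Summable fun k => taylorWeight R k * b l k := fun l =>
    Summable.of_nonneg_of_le (fun k => mul_nonneg (hw0 k) (hb0 l k))
      (fun k => mul_le_of_le_one_right (hw0 k) (by simpa using hb1 {l} k)) hw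
  -- Grouping indices by the value of g costs the factor M; Bessel for the k-th monomial handles the
  -- distinct values.
  have hfib : ∀ k, ∑ i ∈ F, b (g i) k ≤ M := by
    intro k
    rw [Finset.sum_comp (fun l => b l k) g]
    calc ∑ l ∈ F.image g, {i ∈ F | g i = l}.card • b l k
        ≤ ∑ l ∈ F.image g, (M : ℝ) * b l k := by
          refine Finset.sum_le_sum fun l _ => ?_
          rw [nsmul_eq_mul]
          refine mul_le_mul_of_nonneg_right ?_ (hb0 l k)
          have h := hM l
          rw [← Finset.coe_filter, Set.encard_coe_eq_coe_finsetCard] at h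
          exact_mod_cast h
      _ = M * ∑ l ∈ F.image g, b l k := by rw [Finset.mul_sum]
      _ ≤ M := mul_le_of_le_one_right (Nat.cast_nonneg M) (hb1 _ k)
  calc ∑ i ∈ F, ‖⟪expLp μ (g i : Plane), expLp μ (y i)⟫_ℂ‖ ^ 2
      ≤ ∑ i ∈ F, (∑' k, taylorWeight R k) * ∑' k, taylorWeight R k * b (g i) k :=
        Finset.sum_le_sum fun i _ => norm_sq_inner_expLp_le hμ _ (hy i)
    _ = (∑' k, taylorWeight R k) * ∑' k, taylorWeight R k * ∑ i ∈ F, b (g i) k := by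
        rw [← Finset.mul_sum, ← Summable.tsum_finsetSum fun i _ => hwb (g i)]
        simp only [Finset.mul_sum]
    _ ≤ (∑' k, taylorWeight R k) * ∑' k, taylorWeight R k * M := by
        refine mul_le_mul_of_nonneg_left ?_ (tsum_nonneg hw0)
        refine Summable.tsum_le_tsum (fun k => mul_le_mul_of_nonneg_left (hfib k) (hw0 k)) ?_
          (hw.mul_right _)
        simp only [Finset.mul_sum]
        exact summable_sum fun i _ => hwb (g i)
    _ = (∑' k, taylorWeight R k) ^ 2 * M := by rw [tsum_mul_right]; ring

end

/-! ### Parseval's identity for the indicator function of a cell -/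

/-- The parameter g cancels in the difference of the two frequencies. It is free so that it can be
taken near A⁻ⁿl, making the second frequency bounded. -/
theorem setIntegral_expLp_cell {q₁ q₂ : ℤ} (h₁ : 1 ≤ q₁) (h₂ : 1 ≤ q₂) (n : ℕ) (l g : Plane) :
    ∫ x in cell q₁ q₂ n, expLp (sierpinskiMeasure q₁ q₂) l x ∂(sierpinskiMeasure q₁ q₂) =
      (3⁻¹ : ℂ) ^ n * ⟪expLp (sierpinskiMeasure q₁ q₂) (-g),
        expLp (sierpinskiMeasure q₁ q₂) (invPow q₁ q₂ n l - g)⟫_ℂ := by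
  have h : ∫ x in cell q₁ q₂ n, expLp (sierpinskiMeasure q₁ q₂) l x ∂(sierpinskiMeasure q₁ q₂) =
      ∫ x in cell q₁ q₂ n, expFun l x ∂(sierpinskiMeasure q₁ q₂) :=
    integral_congr_ae (ae_restrict_of_ae (memLp_expFun _ l).coeFn_toLp)
  rw [h, restrict_cell h₁ h₂, integral_smul_measure,
    integral_map (continuous_invPow _ _ _).measurable.aemeasurable
      (continuous_expFun l).aestronglyMeasurable]
  nth_rw 2 [expLp]
  rw [inner_expLp]
  simp only [← expFun_add, ENNReal.toReal_pow, ENNReal.toReal_inv, ENNReal.toReal_ofNat]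
  rw [Complex.real_smul]
  push_cast
  congr 1
  refine integral_congr_ae (ae_of_all _ fun x => ?_)
  simp only [expFun, neg_neg, add_sub_cancel, inner_invPow h₁ h₂]

theorem hasSum_norm_sq_setIntegral_cell {q₁ q₂ : ℤ} (h₁ : 1 ≤ q₁) (h₂ : 1 ≤ q₂) {Λ : Set Plane}
    (hΛ : IsSpectrum (sierpinskiMeasure q₁ q₂) Λ) (n : ℕ) :
    HasSum (fun l : Λ => ‖∫ x in cell q₁ q₂ n, expLp (sierpinskiMeasure q₁ q₂) l x
      ∂(sierpinskiMeasure q₁ q₂)‖ ^ 2) ((3⁻¹ : ℝ) ^ n) := by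
  let b := HilbertBasis.mk hΛ.2.1 hΛ.2.2.ge
  have hb : ∀ l : Λ, b l = expLp (sierpinskiMeasure q₁ q₂) l := fun l => by
    simp only [b, HilbertBasis.coe_mk]
  have hfin : sierpinskiMeasure q₁ q₂ (cell q₁ q₂ n) ≠ ⊤ := measure_ne_top _ _
  let f : Lp ℂ 2 (sierpinskiMeasure q₁ q₂) := indicatorConstLp 2 (measurableSet_cell q₁ q₂ n) hfin 1
  have hf : ‖f‖ ^ 2 = (3⁻¹ : ℝ) ^ n := by
    have h : ‖f‖ = _ := norm_indicatorConstLp (by norm_num) (by norm_num)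
    rw [h, Measure.real, measure_cell h₁ h₂, norm_one, one_mul, ← Real.rpow_natCast,
      ← Real.rpow_mul ENNReal.toReal_nonneg]
    simp
  have hsum := Complex.hasSum_re (b.hasSum_inner_mul_inner f f)
  have hre : (⟪f, f⟫_ℂ).re = ‖f‖ ^ 2 := by
    rw [inner_self_eq_norm_sq_to_K]
    simp [← Complex.ofReal_pow]
  rw [hre, hf] at hsum
  convert hsum using 1
  funext l
  have h : ⟪f, b l⟫_ℂ = ∫ x in cell q₁ q₂ n, expLp (sierpinskiMeasure q₁ q₂) l x
      ∂(sierpinskiMeasure q₁ q₂) := by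
    rw [hb]
    exact L2.inner_indicatorConstLp_one _ _ _
  rw [← inner_conj_symm (b l) f, Complex.mul_conj, h, Complex.ofReal_re, Complex.normSq_eq_norm_sq]

/-- Parseval for the cell gives 3⁻ⁿ as 3⁻²ⁿ times a sum that the perturbed Bessel inequality
controls, with fibers counted by M. -/
theorem three_pow_le_of_isSpectrum {q₁ q₂ : ℤ} (h₁ : 1 ≤ q₁) (h₂ : 1 ≤ q₂) {Λ : Set Plane}
    (hΛ : IsSpectrum (sierpinskiMeasure q₁ q₂) Λ) (n : ℕ) {R : ℝ} (hR : 0 ≤ R)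
    (hnear : ∀ l ∈ Λ, ∃ g ∈ Λ, ‖invPow q₁ q₂ n l - g‖ ≤ R) {M : ℕ}
    (hM : ∀ g ∈ Λ, {l ∈ Λ | ‖invPow q₁ q₂ n l - g‖ ≤ R}.encard ≤ M) :
    (3 : ℝ) ^ n ≤ (∑' k, taylorWeight R k) ^ 2 * M := by
  have := isProbabilityMeasure_sierpinskiMeasure h₁ h₂
  choose g hg using fun l : Λ => hnear l l.2
  have hb : ∀ᵐ x ∂(sierpinskiMeasure q₁ q₂), ‖x‖ ≤ 1 :=
    (ae_sierpinskiMeasure h₁ h₂).mono fun x hx => hx.1.trans (by norm_num)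
  have hle : (3⁻¹ : ℝ) ^ n ≤ (3⁻¹ ^ n) ^ 2 * ((∑' k, taylorWeight R k) ^ 2 * M) := by
    refine hasSum_le_of_sum_le (hasSum_norm_sq_setIntegral_cell h₁ h₂ hΛ n) fun F => ?_
    have hterm : ∀ l : Λ, ‖∫ x in cell q₁ q₂ n, expLp (sierpinskiMeasure q₁ q₂) l x
        ∂(sierpinskiMeasure q₁ q₂)‖ ^ 2 = (3⁻¹ ^ n) ^ 2 *
          ‖⟪expLp (sierpinskiMeasure q₁ q₂) (g l),
            expLp (sierpinskiMeasure q₁ q₂) (-(invPow q₁ q₂ n l - g l))⟫_ℂ‖ ^ 2 := by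
      intro l
      -- Conjugation negates both frequencies, replacing -g, which need not lie in Λ, by g ∈ Λ.
      rw [setIntegral_expLp_cell h₁ h₂ n l (g l), norm_mul, mul_pow, norm_pow, norm_inv,
        Complex.norm_ofNat, inner_expLp_expLp, inner_expLp_expLp, ← Complex.norm_conj,
        ← charFun_neg, ← smul_neg]
      congr 5
      abel
    simp only [hterm, ← Finset.mul_sum]
    refine mul_le_mul_of_nonneg_left ?_ (by positivity)
    refine sum_norm_sq_inner_expLp_le hb hΛ.2.1 hR F (fun l => ⟨g l, (hg l).1⟩) _
      (fun l => by rw [norm_neg]; exact (hg l).2) fun γ => ?_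
    refine le_trans ?_ (hM γ γ.2)
    refine Set.encard_le_encard_of_injOn (f := Subtype.val) ?_ Subtype.val_injective.injOn
    rintro l ⟨-, rfl⟩
    exact ⟨l.2, (hg l).2⟩
  have h3 : (0 : ℝ) < 3⁻¹ ^ n := by positivity
  have h3' : (3 : ℝ) ^ n * 3⁻¹ ^ n = 1 := by rw [← mul_pow]; norm_num
  have := mul_le_mul_of_nonneg_left hle (by positivity : (0 : ℝ) ≤ (3 ^ n) ^ 2)
  calc (3 : ℝ) ^ n = (3 ^ n) ^ 2 * 3⁻¹ ^ n := by rw [sq, mul_assoc, h3', mul_one]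
    _ ≤ _ := this
    _ = (3 ^ n * 3⁻¹ ^ n) ^ 2 * ((∑' k, taylorWeight R k) ^ 2 * M) := by ring
    _ = _ := by rw [h3']; ring

/-! ### Lower bound for the density of a spectrum -/

theorem exists_norm_invPow_sub_le {q₁ q₂ : ℤ} {Λ : Set Plane} {p : ℕ}
    (h : ⨆ l ∈ Λ, ⨅ γ ∈ Λ, ‖invPow q₁ q₂ p l - γ‖ₑ < ⊤) :
    ∃ C : ℝ, 0 ≤ C ∧ ∀ l ∈ Λ, ∃ γ ∈ Λ, ‖invPow q₁ q₂ p l - γ‖ ≤ C := by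
  set S := ⨆ l ∈ Λ, ⨅ γ ∈ Λ, ‖invPow q₁ q₂ p l - γ‖ₑ
  -- The infimum over γ need not be attained; the extra 1 leaves room for an actual γ.
  refine ⟨S.toReal + 1, by positivity, fun l hl => ?_⟩
  have hlt : ⨅ γ ∈ Λ, ‖invPow q₁ q₂ p l - γ‖ₑ < ENNReal.ofReal (S.toReal + 1) := by
    refine (le_iSup₂ (f := fun l (_ : l ∈ Λ) => ⨅ γ ∈ Λ, ‖invPow q₁ q₂ p l - γ‖ₑ) l hl).trans_lt ?_
    rw [ENNReal.lt_ofReal_iff_toReal_lt h.ne]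
    linarith
  simp only [iInf_lt_iff] at hlt
  obtain ⟨γ, hγ, hlt⟩ := hlt
  refine ⟨γ, hγ, ?_⟩
  rw [← ofReal_norm] at hlt
  exact (ENNReal.ofReal_lt_ofReal_iff (by positivity)).1 hlt |>.le

/-- Each step contracts the old error by at least 3 and adds at most C, and the bound 2C is stable
because 2C/3 + C ≤ 2C. -/
theorem exists_norm_invPow_mul_sub_le {q₁ q₂ : ℤ} (h₁ : 1 ≤ q₁) (h₂ : 1 ≤ q₂) {Λ : Set Plane}
    {p : ℕ} (hp : 1 ≤ p) {C : ℝ} (hC : 0 ≤ C)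
    (h : ∀ l ∈ Λ, ∃ γ ∈ Λ, ‖invPow q₁ q₂ p l - γ‖ ≤ C) (n : ℕ) :
    ∀ l ∈ Λ, ∃ γ ∈ Λ, ‖invPow q₁ q₂ (n * p) l - γ‖ ≤ 2 * C := by
  intro l hl
  induction n with
  | zero => exact ⟨l, hl, by simpa [invPow_zero] using hC⟩
  | succ n ih =>
    obtain ⟨γ, hγ, hn⟩ := ih
    obtain ⟨δ, hδ, hp'⟩ := h γ hγ
    refine ⟨δ, hδ, ?_⟩
    have hsplit : invPow q₁ q₂ ((n + 1) * p) l - δ =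
        invPow q₁ q₂ p (invPow q₁ q₂ (n * p) l - γ) + (invPow q₁ q₂ p γ - δ) := by
      rw [map_sub, ← invPow_add, add_comm p, ← Nat.succ_mul]
      abel
    have h3 : ((1 : ℝ) / 3) ^ p ≤ 1 / 3 := by
      simpa using pow_le_pow_of_le_one (by norm_num : (0 : ℝ) ≤ 1 / 3) (by norm_num) hp
    calc ‖invPow q₁ q₂ ((n + 1) * p) l - δ‖
        ≤ ‖invPow q₁ q₂ p (invPow q₁ q₂ (n * p) l - γ)‖ + ‖invPow q₁ q₂ p γ - δ‖ := by
          rw [hsplit]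
          exact norm_add_le _ _
      _ ≤ 1 / 3 * (2 * C) + C := by
          refine add_le_add ((norm_invPow_le h₁ h₂ _ _).trans ?_) hp'
          exact mul_le_mul h3 hn (norm_nonneg _) (by norm_num)
      _ ≤ 2 * C := by linarith

/-- By q₁ ≤ q₂, no direction is expanded by Aⁿ more than (3q₂)ⁿ. -/
theorem norm_le_mul_norm_invPow {q₁ q₂ : ℤ} (h₁ : 1 ≤ q₁) (h₂ : q₁ ≤ q₂) (n : ℕ) (x : Plane) :
    ‖x‖ ≤ (3 * (q₂ : ℝ)) ^ n * ‖invPow q₁ q₂ n x‖ := by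
  have hb₁ := one_lt_three_mul_cast h₁
  have hb : 3 * (q₁ : ℝ) ≤ 3 * q₂ := by
    have : (q₁ : ℝ) ≤ q₂ := by exact_mod_cast h₂
    linarith
  have hsq : ∀ y : Plane, ‖y‖ ^ 2 = y 0 ^ 2 + y 1 ^ 2 := fun y => by
    rw [← real_inner_self_eq_norm_sq, inner_plane]
    ring
  have hone : ∀ {a b t : ℝ}, 1 < a → a ≤ b → t ^ 2 ≤ (b ^ n) ^ 2 * (a⁻¹ ^ n * t) ^ 2 := by
    intro a b t ha hab
    have h0 : (0 : ℝ) < a := by linarith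
    have ht : t = a ^ n * (a⁻¹ ^ n * t) := by
      rw [← mul_assoc, ← mul_pow, mul_inv_cancel₀ h0.ne', one_pow, one_mul]
    conv_lhs => rw [ht, mul_pow]
    gcongr
  refine le_of_sq_le_sq ?_ (mul_nonneg (pow_nonneg (by linarith) n) (norm_nonneg _))
  rw [mul_pow, hsq, hsq, mul_add, invPow_apply_zero h₁ (h₁.trans h₂),
    invPow_apply_one h₁ (h₁.trans h₂)]
  exact add_le_add (hone hb₁ hb) (hone (hb₁.trans_le hb) le_rfl)

theorem exists_invPow_eq {q₁ q₂ : ℤ} (h₁ : 1 ≤ q₁) (h₂ : 1 ≤ q₂) (n : ℕ) (g : Plane) :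
    ∃ x, invPow q₁ q₂ n x = g := by
  have hb₁ := one_lt_three_mul_cast h₁
  have hb₂ := one_lt_three_mul_cast h₂
  refine ⟨!₂[(3 * (q₁ : ℝ)) ^ n * g 0, (3 * (q₂ : ℝ)) ^ n * g 1], plane_ext ?_ ?_⟩
  · rw [invPow_apply_zero h₁ h₂]
    change (3 * (q₁ : ℝ))⁻¹ ^ n * ((3 * (q₁ : ℝ)) ^ n * g 0) = g 0
    rw [← mul_assoc, ← mul_pow, inv_mul_cancel₀ (by linarith), one_pow, one_mul]
  · rw [invPow_apply_one h₁ h₂]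
    change (3 * (q₂ : ℝ))⁻¹ ^ n * ((3 * (q₂ : ℝ)) ^ n * g 1) = g 1
    rw [← mul_assoc, ← mul_pow, inv_mul_cancel₀ (by linarith), one_pow, one_mul]

theorem exists_le_iSup_encard {q₁ q₂ : ℤ} (h₁ : 1 ≤ q₁) (h₂ : q₁ ≤ q₂) {Λ : Set Plane}
    (hΛ : IsSpectrum (sierpinskiMeasure q₁ q₂) Λ) {R : ℝ} (hR : 0 ≤ R) :
    ∃ c : ℝ, 0 < c ∧ ∀ n, (∀ l ∈ Λ, ∃ γ ∈ Λ, ‖invPow q₁ q₂ n l - γ‖ ≤ R) →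
      ENNReal.ofReal (c * 3 ^ n) ≤
        ⨆ x, ((Λ ∩ Metric.ball x ((R + 1) * (3 * (q₂ : ℝ)) ^ n)).encard : ℝ≥0∞) := by
  have h₂' := h₁.trans h₂
  have hb₂ := one_lt_three_mul_cast h₂'
  set W := ∑' k, taylorWeight R k
  -- The constant times W² is below 1, which contradicts `three_pow_le_of_isSpectrum`; the summand 1
  -- keeps the denominator positive.
  refine ⟨1 / (2 * (W ^ 2 + 1)), by positivity, fun n hn => ?_⟩
  by_contra! hlt
  set c := 1 / (2 * (W ^ 2 + 1)) * 3 ^ n with hc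
  have hc0 : 0 ≤ c := by positivity
  have hcard : ∀ g ∈ Λ, {l ∈ Λ | ‖invPow q₁ q₂ n l - g‖ ≤ R}.encard ≤ (⌊c⌋₊ : ℕ) := by
    intro g _
    obtain ⟨x, rfl⟩ := exists_invPow_eq h₁ h₂' n g
    -- Enlarging R to R + 1 fits the closed condition into an open ball.
    have hsub : {l ∈ Λ | ‖invPow q₁ q₂ n l - invPow q₁ q₂ n x‖ ≤ R} ⊆
        Λ ∩ Metric.ball x ((R + 1) * (3 * (q₂ : ℝ)) ^ n) := by
      rintro l ⟨hl, hlR⟩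
      refine ⟨hl, ?_⟩
      rw [← map_sub] at hlR
      rw [Metric.mem_ball, dist_eq_norm, mul_comm]
      refine (norm_le_mul_norm_invPow h₁ h₂ n _).trans_lt ?_
      exact mul_lt_mul_of_pos_left (by linarith) (by positivity)
    refine (Set.encard_le_encard hsub).trans ?_
    have hx := (le_iSup (fun x => ((Λ ∩ Metric.ball x
      ((R + 1) * (3 * (q₂ : ℝ)) ^ n)).encard : ℝ≥0∞)) x).trans_lt hlt
    generalize (Λ ∩ Metric.ball x ((R + 1) * (3 * (q₂ : ℝ)) ^ n)).encard = e at hx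
    induction e using ENat.recTopCoe with
    | top => simp at hx
    | coe k =>
      rw [ENNReal.lt_ofReal_iff_toReal_lt (by simp)] at hx
      have hk : (k : ℝ) < c := by simpa using hx
      exact_mod_cast Nat.le_floor hk.le
  have h3 := three_pow_le_of_isSpectrum h₁ h₂' hΛ n hR hn hcard
  have hW : W ^ 2 * (⌊c⌋₊ : ℝ) ≤ W ^ 2 * c :=
    mul_le_mul_of_nonneg_left (Nat.floor_le hc0) (sq_nonneg W)
  have hpos : (0 : ℝ) < 3 ^ n := by positivity
  have hceq : c * (2 * (W ^ 2 + 1)) = 3 ^ n := by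
    rw [hc]
    field_simp
  nlinarith [sq_nonneg W]

/-- A limsup is bounded below along a sequence of scales, here h = R(3q₂)^{np}, where the count is
at least c·3^{np}, that is c times (3q₂)^{np} to the power s ≥ r. -/
theorem upperBeurlingDensity_ne_zero {q₁ q₂ : ℤ} (h₁ : 1 ≤ q₁) (h₂ : q₁ ≤ q₂) {Λ : Set Plane}
    (hΛ : IsSpectrum (sierpinskiMeasure q₁ q₂) Λ) {p : ℕ} (hp : 1 ≤ p)
    (h : ⨆ l ∈ Λ, ⨅ γ ∈ Λ, ‖invPow q₁ q₂ p l - γ‖ₑ < ⊤) {r : ℝ}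
    (hr : r ≤ Real.log 3 / Real.log (3 * (q₂ : ℝ))) : upperBeurlingDensity r Λ ≠ 0 := by
  have h₂' := h₁.trans h₂
  have hb := one_lt_three_mul_cast h₂'
  obtain ⟨C, hC, hnear⟩ := exists_norm_invPow_sub_le h
  obtain ⟨c, hc, hcard⟩ := exists_le_iSup_encard h₁ h₂ hΛ (R := 2 * C) (by positivity)
  -- The radius 2C from iterating the hypothesis, plus the 1 from `exists_le_iSup_encard`.
  set R := 2 * C + 1 with hR
  have hR0 : 0 < R := by positivity
  have hpos : 0 < c / R ^ r := div_pos hc (Real.rpow_pos_of_pos hR0 r)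
  have hlim : Tendsto (fun n : ℕ => R * (3 * (q₂ : ℝ)) ^ (n * p)) atTop atTop := by
    refine Tendsto.const_mul_atTop hR0 ((tendsto_pow_atTop_atTop_of_one_lt hb).comp ?_)
    exact tendsto_id.atTop_mul_const' (by omega)
  refine (lt_of_lt_of_le (ENNReal.ofReal_pos.2 hpos) ?_).ne'
  refine le_limsup_of_frequently_le' (hlim.frequently (Frequently.of_forall fun n => ?_))
  have hb0 : (0 : ℝ) < (3 * (q₂ : ℝ)) ^ (n * p) := by positivity
  have hh : 0 < (R * (3 * (q₂ : ℝ)) ^ (n * p)) ^ r := Real.rpow_pos_of_pos (by positivity) r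
  rw [← ENNReal.iSup_div, ENNReal.le_div_iff_mul_le (Or.inl (by simpa using hh))
    (Or.inl ENNReal.ofReal_ne_top), ← ENNReal.ofReal_mul hpos.le]
  refine le_trans (ENNReal.ofReal_le_ofReal ?_)
    (hcard (n * p) (exists_norm_invPow_mul_sub_le h₁ h₂' hp hC hnear n))
  rw [Real.mul_rpow hR0.le hb0.le, ← mul_assoc, div_mul_cancel₀ _ (Real.rpow_pos_of_pos hR0 r).ne',
    three_pow_eq_rpow hb]
  exact mul_le_mul_of_nonneg_left
    (Real.rpow_le_rpow_of_exponent_le (one_le_pow₀ hb.le) hr) hc.le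

theorem le_beurlingDim {q₁ q₂ : ℤ} (h₁ : 1 ≤ q₁) (h₂ : q₁ ≤ q₂) {Λ : Set Plane}
    (hΛ : IsSpectrum (sierpinskiMeasure q₁ q₂) Λ) {p : ℕ} (hp : 1 ≤ p)
    (h : ⨆ l ∈ Λ, ⨅ γ ∈ Λ, ‖invPow q₁ q₂ p l - γ‖ₑ < ⊤) :
    ENNReal.ofReal (Real.log 3 / Real.log (3 * (q₂ : ℝ))) ≤ beurlingDim Λ := by
  refine le_iInf fun r => le_iInf fun _ => le_iInf fun hr0 => ENNReal.ofReal_le_ofReal ?_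
  by_contra! hr
  exact upperBeurlingDensity_ne_zero h₁ h₂ hΛ hp h hr.le hr0

theorem IsSpectrum.isOrthogonalSet {μ : Measure Plane} [IsFiniteMeasure μ] {Λ : Set Plane}
    (hΛ : IsSpectrum μ Λ) : IsOrthogonalSet μ Λ := fun l hl m hm hlm =>
  hΛ.2.1.2 (i := ⟨l, hl⟩) (j := ⟨m, hm⟩) fun h => hlm (congrArg Subtype.val h)

end Sierpinski

theorem theorem1p3 (q₁ q₂ : ℤ) (hq₁ : 1 ≤ q₁) (hq₂ : q₁ ≤ q₂) :
    (∀ Λ : Set Sierpinski.Plane,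
      Sierpinski.IsOrthogonalSet (Sierpinski.sierpinskiMeasure q₁ q₂) Λ →
      Sierpinski.beurlingDim Λ ≤ ENNReal.ofReal (Real.log 3 / Real.log (3 * (q₂ : ℝ)))) ∧
    (∀ Λ : Set Sierpinski.Plane,
      Sierpinski.IsSpectrum (Sierpinski.sierpinskiMeasure q₁ q₂) Λ →
      (∃ p : ℕ, 1 ≤ p ∧
        ⨆ l ∈ Λ, ⨅ γ ∈ Λ,
          ‖Matrix.toEuclideanLin ((Sierpinski.matA q₁ q₂)⁻¹ ^ p) l - γ‖ₑ < ⊤) →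
      Sierpinski.beurlingDim Λ = ENNReal.ofReal (Real.log 3 / Real.log (3 * (q₂ : ℝ)))) := by
  refine ⟨fun Λ hΛ => Sierpinski.beurlingDim_le hq₁ (hq₁.trans hq₂) hΛ, ?_⟩
  rintro Λ hΛ ⟨p, hp, h⟩
  exact le_antisymm (Sierpinski.beurlingDim_le hq₁ (hq₁.trans hq₂) hΛ.isOrthogonalSet)
    (Sierpinski.le_beurlingDim hq₁ hq₂ hΛ hp h)
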